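/- Let $\mathcal X,\mathcal Y_1,\mathcal Y_2$ be finite sets and let $P=P_{XY_1Y_2}$, $\bar P=\bar P_{XY_1Y_2}$ be pmfs on $\mathcal X\times\mathcal Y_1\times\mathcal Y_2$ with $P_{XY_1}(x,y_1)>0$ and $\bar P_{XY_1Y_2}(x,y_1,y_2)>0$ for all $(x,y_1,y_2)$; subscripts denote marginals. Under hypothesis $\mathcal H=0$ (resp. $\mathcal H=1$) the triples $(X_t,Y_{1,t},Y_{2,t})$, $t=1,\dots,n$, are i.i.d. according to $P$ (resp. $\bar P$). For integers $\mathsf W_1,\mathsf W_2\ge 2$, a scheme of blocklength $n$ consists of functions $$\phi_{1,n}\colon\mathcal X^n\to\mathcal M_1,\quad \phi_{2,n}\colon\mathcal M_1\times\mathcal Y_1^n\to\mathcal M_2,\quad \psi_{1,n}\colon\mathcal M_1\times\mathcal Y_1^n\to\{0,1\},\quad \psi_{2,n}\colon\mathcal M_1\times\mathcal M_2\times\mathcal Y_2^n\to\{0,1\},$$ where $\mathcal M_i=\{0,\dots,\mathsf W_i-1\}$. Put $M_1=\phi_{1,n}(X^n)$ (sent by the sensor to both detectors), $M_2=\phi_{2,n}(M_1,Y_1^n)$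 (sent by Detector 1 to Detector 2), $\hat{\mathcal H}_1=\psi_{1,n}(M_1,Y_1^n)$ and $\hat{\mathcal H}_2=\psi_{2,n}(M_1,M_2,Y_2^n)$. In coherent detection ($\bar h_1=1$) the error probabilities are, for $i=1,2$, $$\alpha_{i,n}=\Pr\{\hat{\mathcal H}_i=1\mid\mathcal H=0\},\qquad \beta_{i,n}=\Pr\{\hat{\mathcal H}_i=0\mid\mathcal H=1\}.$$ A pair $(\theta_1,\theta_2)$ of nonnegative reals is achievable if there are schemes for all blocklengths $n$ such that, for $i=1,2$, $$\varlimsup_{n\to\infty}\alpha_{i,n}\le 0,\qquad \theta_i\le\varliminf_{n\to\infty}-\tfrac1n\log\beta_{i,n}$$ (with $-\log 0=+\infty$). Let $\mathcal E_0(\mathsf W_1,\mathsf W_2)$ be the closure of the set of achievable pairs. Then, for all $\mathsf W_1,\mathsf W_2\ge 2$, the region $\mathcal E_0(\mathsf W_1,\mathsf W_2)$ is the rectangle of all pairs $(\theta_1,\theta_2)$ of nonnegative reals with $$\theta_1\le\min_{\substack{\tilde P_{XY_1}\colon\ \tilde P_X=P_X\\ \tilde P_{Y_1}=P_{Y_1}}}D\big(\tilde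 P_{XY_1}\,\|\,\bar P_{XY_1}\big),\qquad \theta_2\le\min_{\substack{\tilde P_{XY_1Y_2}\colon\ \tilde P_X=P_X\\ \tilde P_{Y_1}=P_{Y_1},\ \tilde P_{Y_2}=P_{Y_2}}}D\big(\tilde P_{XY_1Y_2}\,\|\,\bar P_{XY_1Y_2}\big),$$ where $D$ is the Kullback–Leibler divergence (with the same logarithm as above) and both minima are attained and finite. -/

import Mathlib

open Filter Topology MeasureTheory
open scoped NNReal ENNReal

/-- The functions used at blocklength `n`, with communication alphabets of sizes `W₁` and `W₂`:
the sensor's encoder, Detector 1's encoder and decision rule, and Detector 2's decision rule. -/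
structure Scheme (X Y₁ Y₂ : Type*) (W₁ W₂ n : ℕ) where
  φ₁ : (Fin n → X) → Fin W₁
  φ₂ : Fin W₁ → (Fin n → Y₁) → Fin W₂
  ψ₁ : Fin W₁ → (Fin n → Y₁) → Fin 2
  ψ₂ : Fin W₁ → Fin W₂ → (Fin n → Y₂) → Fin 2

namespace Scheme

variable {X Y₁ Y₂ : Type*} {W₁ W₂ n : ℕ}

/-- The message of the sensor (sent to both detectors), as a function of all observations. -/
def M₁ (s : Scheme X Y₁ Y₂ W₁ W₂ n) (z : Fin n → X × Y₁ × Y₂) : Fin W₁ :=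
  s.φ₁ fun t => (z t).1

/-- The message of Detector 1 to Detector 2. -/
def M₂ (s : Scheme X Y₁ Y₂ W₁ W₂ n) (z : Fin n → X × Y₁ × Y₂) : Fin W₂ :=
  s.φ₂ (s.M₁ z) fun t => (z t).2.1

/-- The decision of Detector 1. -/
def decision₁ (s : Scheme X Y₁ Y₂ W₁ W₂ n) (z : Fin n → X × Y₁ × Y₂) : Fin 2 :=
  s.ψ₁ (s.M₁ z) fun t => (z t).2.1

/-- The decision of Detector 2. -/
def decision₂ (s : Scheme X Y₁ Y₂ W₁ W₂ n) (z : Fin n → X × Y₁ × Y₂) : Fin 2 :=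
  s.ψ₂ (s.M₁ z) (s.M₂ z) fun t => (z t).2.2

end Scheme

/-- The law of `n` i.i.d. draws from the pmf `Q`. -/
noncomputable def iidLaw {Z : Type*} [MeasurableSpace Z] (Q : PMF Z) (n : ℕ) :
    Measure (Fin n → Z) :=
  Measure.pi fun _ => Q.toMeasure

section ErrorProbabilities

variable {X Y₁ Y₂ : Type*} [MeasurableSpace X] [MeasurableSpace Y₁] [MeasurableSpace Y₂]
  {W₁ W₂ n : ℕ}

/-- `Pr {Ĥ₁ = g | H = h}`, where `Q h` is the single-letter law under hypothesis `h`. -/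
noncomputable def prDecision₁ (Q : Fin 2 → PMF (X × Y₁ × Y₂))
    (s : Scheme X Y₁ Y₂ W₁ W₂ n) (g h : Fin 2) : ℝ≥0∞ :=
  iidLaw (Q h) n {z | s.decision₁ z = g}

/-- `Pr {Ĥ₂ = g | H = h}`, where `Q h` is the single-letter law under hypothesis `h`. -/
noncomputable def prDecision₂ (Q : Fin 2 → PMF (X × Y₁ × Y₂))
    (s : Scheme X Y₁ Y₂ W₁ W₂ n) (g h : Fin 2) : ℝ≥0∞ :=
  iidLaw (Q h) n {z | s.decision₂ z = g}

/-- `liminf_{n → ∞} -(1/n) log β n`, in the extended reals, with `-log 0 = +∞`. -/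
noncomputable def errorExponent (β : ℕ → ℝ≥0∞) : EReal :=
  liminf (fun n : ℕ => -(ENNReal.log (β n)) / (n : EReal)) atTop

/-- Achievability of the (nonnegative) exponent pair `θ` with fixed communication alphabets of
sizes `W₁` and `W₂`. Detector 1 maximizes its exponent under the hypothesis `hbar` (called `h̄₁`);
the other hypothesis `h₁` is `hbar + 1` in `Fin 2`. Detector 2 always maximizes its exponent under
hypothesis `1`. -/
def Achievable (Q : Fin 2 → PMF (X × Y₁ × Y₂)) (hbar : Fin 2) (W₁ W₂ : ℕ) (θ : ℝ × ℝ) : Prop :=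
  0 ≤ θ.1 ∧ 0 ≤ θ.2 ∧
  ∃ s : ∀ n : ℕ, Scheme X Y₁ Y₂ W₁ W₂ n,
    limsup (fun n => prDecision₁ Q (s n) hbar (hbar + 1)) atTop ≤ 0 ∧
    limsup (fun n => prDecision₂ Q (s n) 1 0) atTop ≤ 0 ∧
    (θ.1 : EReal) ≤ errorExponent (fun n => prDecision₁ Q (s n) (hbar + 1) hbar) ∧
    (θ.2 : EReal) ≤ errorExponent (fun n => prDecision₂ Q (s n) 0 1)

/-- The error-exponents region `E₀(W₁, W₂)`: the closure of the set of achievable pairs. -/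
def exponentsRegion (Q : Fin 2 → PMF (X × Y₁ × Y₂)) (hbar : Fin 2) (W₁ W₂ : ℕ) : Set (ℝ × ℝ) :=
  closure {θ | Achievable Q hbar W₁ W₂ θ}

end ErrorProbabilities

namespace PMF

variable {X Y₁ Y₂ : Type*}

/-- The marginal of the first component of a pmf on `X × Y₁ × Y₂`. -/
noncomputable def margX (P : PMF (X × Y₁ × Y₂)) : PMF X := P.map fun z => z.1

/-- The marginal of the second component. -/
noncomputable def margY₁ (P : PMF (X × Y₁ × Y₂)) : PMF Y₁ := P.map fun z => z.2.1

/-- The marginal of the third component. -/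
noncomputable def margY₂ (P : PMF (X × Y₁ × Y₂)) : PMF Y₂ := P.map fun z => z.2.2

/-- The marginal of the first two components. -/
noncomputable def margXY₁ (P : PMF (X × Y₁ × Y₂)) : PMF (X × Y₁) := P.map fun z => (z.1, z.2.1)

/-- The Kullback-Leibler divergence `D(P‖Q)` of two pmfs (natural logarithm). -/
noncomputable def divergence {Z : Type*} [MeasurableSpace Z] (P Q : PMF Z) : ℝ≥0∞ :=
  InformationTheory.klDiv P.toMeasure Q.toMeasure

end PMF

section Bounds

variable {X Y₁ Y₂ : Type*} [MeasurableSpace X] [MeasurableSpace Y₁] [MeasurableSpace Y₂]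

/-- The values `D(P̃_{XY₁}‖P̄_{XY₁})` over all pmfs `P̃_{XY₁}` with marginals `P_X`, `P_{Y₁}`. -/
def divergences₁ (P Pbar : PMF (X × Y₁ × Y₂)) : Set ℝ≥0∞ :=
  {d | ∃ Pt : PMF (X × Y₁), Pt.map Prod.fst = P.margX ∧ Pt.map Prod.snd = P.margY₁ ∧
    d = Pt.divergence Pbar.margXY₁}

/-- The values `D(P̃_{XY₁Y₂}‖P̄_{XY₁Y₂})` over all pmfs `P̃_{XY₁Y₂}` with marginals `P_X`, `P_{Y₁}`
and `P_{Y₂}`. -/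
def divergences₂ (P Pbar : PMF (X × Y₁ × Y₂)) : Set ℝ≥0∞ :=
  {d | ∃ Pt : PMF (X × Y₁ × Y₂), Pt.margX = P.margX ∧ Pt.margY₁ = P.margY₁ ∧
    Pt.margY₂ = P.margY₂ ∧ d = Pt.divergence Pbar}

end Bounds

/-!
The events on which a detector decides for hypothesis `0` are governed by a bounded number of
message values, and for each of them the event is a rectangle: a product of a set of `x`-sequences,
a set of `y₁`-sequences and (for Detector 2) a set of `y₂`-sequences.

*Converse.* If the error probability under `P` vanishes, one rectangle keeps a probability bounded
below under `P`, so its sides do too under the marginals of `P`. Let `Pt` be any law with these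
marginals. Then the probability of the rectangle under `Pbar` decays at rate at most `D(Pt‖Pbar)`
(`exists_iidLaw_rectangle_ge`). The reason is a reverse Brascamp-Lieb inequality, used in place of
the blowing-up lemma: for nonnegative `f`, `g`, `h`,
`E_Pbar[f g h] ≥ exp (-D(Pt‖Pbar) - δ) ‖f‖_p ‖g‖_p ‖h‖_p`, with norms taken under the marginals and a
small order `p > 0` that depends on `δ` only (`exists_reverse_brascamp_lieb`). As `p → 0` the norms
become geometric means and the inequality becomes the Gibbs variational principle; that a positive
`p` can be chosen uniformly in the functions uses that `Pbar` has full support. The inequality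
tensorizes by iterating it coordinatewise (`reverse_brascamp_lieb_tensorize`), and applied to
indicator functions it loses only a constant factor besides `exp (-n (D + δ))`.

*Achievability.* One-bit messages suffice: each terminal reports whether everything so far is typical
for the marginals of `P`, with a tolerance tending to zero so slowly that Chebyshev's inequality
controls the error under `P`. Under `Pbar`, consider the i.i.d. law conditioned on the acceptance
event `E`, and average its one-letter marginals over time. By superadditivity of relative entropy the
average `R` satisfies `n D(R‖Pbar) ≤ -log Pbar^n(E)` (`mul_relEntropy_averageConditional_le`), and by
typicality the marginals of `R` are close to those of `P`. Compactness of the simplex and continuity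
of the divergence then give the minimal divergence as a lower bound on the exponent. The same schemes
serve both detectors, so the region is the full rectangle.
-/

/-! ### Relative entropy on a finite alphabet -/

/-- The relative entropy `∑ p log (p / q)` of real weight functions on a finite set. Terms with
`p z = 0` vanish; the definition is only used for `q` positive. -/
noncomputable def relEntropy {Z : Type*} [Fintype Z] (p q : Z → ℝ) : ℝ :=
  ∑ z, p z * Real.log (p z / q z)

theorem relEntropy_eq_sum_sub {Z : Type*} [Fintype Z] {q : Z → ℝ} (hq : ∀ z, 0 < q z) (p : Z → ℝ) :
    relEntropy p q = ∑ z, (p z * Real.log (p z) - p z * Real.log (q z)) := by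
  refine Finset.sum_congr rfl fun z _ => ?_
  rcases eq_or_ne (p z) 0 with h | h
  · simp [h]
  · rw [Real.log_div h (hq z).ne', mul_sub]

theorem continuous_relEntropy {Z : Type*} [Fintype Z] {q : Z → ℝ} (hq : ∀ z, 0 < q z) :
    Continuous fun p : Z → ℝ => relEntropy p q := by
  simp_rw [relEntropy_eq_sum_sub hq]
  refine continuous_finsetSum _ fun z _ => Continuous.sub ?_ ?_
  · exact Real.continuous_mul_log.comp (continuous_apply z)
  · exact (continuous_apply z).mul continuous_const

namespace PMF

/-- The weights of a pmf as real numbers. -/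
noncomputable def toRealFun {Z : Type*} (P : PMF Z) (z : Z) : ℝ := (P z).toReal

variable {Z : Type*}

theorem toRealFun_nonneg (P : PMF Z) (z : Z) : 0 ≤ P.toRealFun z := ENNReal.toReal_nonneg

theorem ofReal_toRealFun (P : PMF Z) (z : Z) : ENNReal.ofReal (P.toRealFun z) = P z :=
  ENNReal.ofReal_toReal (P.apply_ne_top z)

theorem toRealFun_pos {P : PMF Z} {z : Z} (h : 0 < P z) : 0 < P.toRealFun z :=
  ENNReal.toReal_pos h.ne' (P.apply_ne_top z)

theorem toRealFun_injective : Function.Injective (toRealFun : PMF Z → Z → ℝ) := by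
  intro P Q h
  ext z
  rw [← P.ofReal_toRealFun, h, Q.ofReal_toRealFun]

theorem absolutelyContinuous_toMeasure [MeasurableSpace Z] (P : PMF Z) {Q : PMF Z}
    (hQ : ∀ z, 0 < Q z) : P.toMeasure ≪ Q.toMeasure := by
  refine Measure.AbsolutelyContinuous.mk fun s hs h => ?_
  rw [Q.toMeasure_apply_eq_zero_iff hs] at h
  have hs : s = ∅ := by
    refine Set.eq_empty_of_forall_notMem fun z hz => ?_
    exact Set.disjoint_left.1 h ((Q.mem_support_iff z).2 (hQ z).ne') hz
  simp [hs]

variable [Fintype Z]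

theorem sum_toRealFun (P : PMF Z) : ∑ z, P.toRealFun z = 1 := by
  unfold toRealFun
  rw [← ENNReal.toReal_sum fun z _ => P.apply_ne_top z, ← tsum_fintype (L := .unconditional _),
    P.tsum_coe, ENNReal.toReal_one]

theorem toRealFun_mem_stdSimplex (P : PMF Z) : P.toRealFun ∈ stdSimplex ℝ Z :=
  ⟨P.toRealFun_nonneg, P.sum_toRealFun⟩

theorem exists_toRealFun_eq {p : Z → ℝ} (hp : p ∈ stdSimplex ℝ Z) :
    ∃ P : PMF Z, P.toRealFun = p := by
  refine ⟨PMF.ofFintype (fun z => ENNReal.ofReal (p z)) ?_, ?_⟩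
  · rw [← ENNReal.ofReal_sum_of_nonneg fun z _ => hp.1 z, hp.2, ENNReal.ofReal_one]
  · funext z
    simp [toRealFun, ENNReal.toReal_ofReal (hp.1 z)]

open Classical in
theorem toRealFun_map {A : Type*} (P : PMF Z) (π : Z → A) (a : A) :
    (P.map π).toRealFun a = ∑ z, P.toRealFun z * if π z = a then 1 else 0 := by
  unfold toRealFun
  rw [PMF.map_apply, tsum_fintype, ENNReal.toReal_sum]
  · refine Finset.sum_congr rfl fun z _ => ?_
    by_cases h : π z = a
    · simp [h]
    · simp [h, Ne.symm h]
  · intro z _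
    split_ifs
    exacts [P.apply_ne_top z, ENNReal.zero_ne_top]

theorem toRealFun_map_pos {A : Type*} {P : PMF Z} (π : Z → A) {z : Z} (hz : 0 < P.toRealFun z) :
    0 < (P.map π).toRealFun (π z) := by
  classical
  rw [PMF.toRealFun_map]
  refine hz.trans_le ?_
  have := Finset.single_le_sum (f := fun z' => P.toRealFun z' *
    if π z' = π z then (1 : ℝ) else 0) (fun z' _ => mul_nonneg (P.toRealFun_nonneg z')
      (by split_ifs <;> norm_num)) (Finset.mem_univ z)
  simpa using this

/-- Change of variables for expectations under the image of a pmf. -/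
theorem sum_toRealFun_map {A : Type*} [Fintype A] (P : PMF Z) (π : Z → A) (f : A → ℝ) :
    ∑ a, (P.map π).toRealFun a * f a = ∑ z, P.toRealFun z * f (π z) := by
  classical
  simp_rw [toRealFun_map, Finset.sum_mul]
  rw [Finset.sum_comm]
  refine Finset.sum_congr rfl fun z _ => ?_
  simp

variable [MeasurableSpace Z] [MeasurableSingletonClass Z]

/-- On a finite alphabet, the Kullback-Leibler divergence with respect to a pmf of full support is
the finite sum `relEntropy`. -/
theorem divergence_eq_ofReal_relEntropy (P : PMF Z) {Q : PMF Z} (hQ : ∀ z, 0 < Q z) :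
    P.divergence Q = ENNReal.ofReal (relEntropy P.toRealFun Q.toRealFun) := by
  have hac := P.absolutelyContinuous_toMeasure hQ
  have hne : InformationTheory.klDiv P.toMeasure Q.toMeasure ≠ ∞ :=
    InformationTheory.klDiv_ne_top hac Integrable.of_finite
  have hrn : ∀ z, P.toMeasure.rnDeriv Q.toMeasure z = P z / Q z := by
    intro z
    have h := Measure.setLIntegral_rnDeriv hac {z}
    rw [lintegral_singleton, Q.toMeasure_apply_singleton z (measurableSet_singleton z),
      P.toMeasure_apply_singleton z (measurableSet_singleton z)] at h
    exact ENNReal.eq_div_iff (hQ z).ne' (Q.apply_ne_top z) |>.2 (by rw [mul_comm, h])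
  unfold PMF.divergence
  rw [← ENNReal.ofReal_toReal hne,
    InformationTheory.toReal_klDiv_of_measure_eq hac (by simp), integral_fintype Integrable.of_finite]
  congr 1
  refine Finset.sum_congr rfl fun z _ => ?_
  rw [llr, hrn, Measure.real, P.toMeasure_apply_singleton z (measurableSet_singleton z),
    ENNReal.toReal_div]
  rfl

end PMF

/-! ### The law of `n` i.i.d. draws -/

section IIDLaw

variable {Z : Type*} [MeasurableSpace Z]

instance (Q : PMF Z) (n : ℕ) : IsProbabilityMeasure (iidLaw Q n) := by
  unfold iidLaw; infer_instance

theorem iidLaw_map {A : Type*} [MeasurableSpace A] (Q : PMF Z) {π : Z → A} (hπ : Measurable π)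
    (n : ℕ) : (iidLaw Q n).map (fun z t => π (z t)) = iidLaw (Q.map π) n := by
  have h := Q.toMeasure_map (f := π) hπ
  unfold iidLaw
  rw [← h]
  have : IsProbabilityMeasure (Q.toMeasure.map π) := by rw [h]; infer_instance
  exact Measure.pi_map_pi fun _ => hπ.aemeasurable

variable [Fintype Z] [MeasurableSingletonClass Z]

theorem iidLaw_map_apply {A : Type*} [Fintype A] [MeasurableSpace A] [MeasurableSingletonClass A]
    (Q : PMF Z) (π : Z → A) (n : ℕ) (S : Set (Fin n → A)) :
    iidLaw (Q.map π) n S = iidLaw Q n {z | (fun t => π (z t)) ∈ S} := by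
  rw [← iidLaw_map Q (measurable_of_finite π) n,
    Measure.map_apply (measurable_of_finite _) S.toFinite.measurableSet]
  rfl

open Classical in
theorem iidLaw_apply (Q : PMF Z) (n : ℕ) (S : Set (Fin n → Z)) :
    iidLaw Q n S =
      ENNReal.ofReal (∑ z : Fin n → Z, (∏ t, Q.toRealFun (z t)) * if z ∈ S then 1 else 0) := by
  have hS : S = ((Finset.univ.filter fun z => z ∈ S : Finset (Fin n → Z)) : Set (Fin n → Z)) := by
    ext; simp
  simp only [mul_ite, mul_one, mul_zero]
  rw [← Finset.sum_filter, ENNReal.ofReal_sum_of_nonneg]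
  · conv_lhs => rw [hS]
    rw [← sum_measure_singleton]
    refine Finset.sum_congr rfl fun z _ => ?_
    rw [iidLaw, Measure.pi_singleton, ENNReal.ofReal_prod_of_nonneg]
    · refine Finset.prod_congr rfl fun t _ => ?_
      rw [Q.toMeasure_apply_singleton _ (measurableSet_singleton _), Q.ofReal_toRealFun]
    · exact fun t _ => Q.toRealFun_nonneg _
  · exact fun z _ => Finset.prod_nonneg fun t _ => Q.toRealFun_nonneg _

end IIDLaw

/-! ### Power means of small order -/

/-- The power mean `(∑ a f ^ p) ^ (1 / p)` of `f` of order `p` with weights `a`. -/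
noncomputable def powerMean {A : Type*} [Fintype A] (a : A → ℝ) (p : ℝ) (f : A → ℝ) : ℝ :=
  (∑ x, a x * f x ^ p) ^ p⁻¹

section PowerMean

variable {A : Type*} {a : A → ℝ} {p : ℝ} {f : A → ℝ}

theorem mul_rpow_le_of_le_one (ha : ∀ x, 0 ≤ a x) (hf : ∀ x, 0 ≤ f x)
    (hf1 : ∀ x, 0 < a x → f x ≤ 1) (hp : 0 < p) (x : A) : a x * f x ^ p ≤ a x := by
  rcases (ha x).eq_or_lt with h | h
  · simp [← h]
  · exact mul_le_of_le_one_right h.le (Real.rpow_le_one (hf x) (hf1 x h) hp.le)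

variable [Fintype A]

theorem sum_mul_rpow_nonneg (ha : ∀ x, 0 ≤ a x) (hf : ∀ x, 0 ≤ f x) (p : ℝ) :
    0 ≤ ∑ x, a x * f x ^ p :=
  Finset.sum_nonneg fun x _ => mul_nonneg (ha x) (Real.rpow_nonneg (hf x) p)

theorem powerMean_nonneg (ha : ∀ x, 0 ≤ a x) (hf : ∀ x, 0 ≤ f x) (p : ℝ) :
    0 ≤ powerMean a p f :=
  Real.rpow_nonneg (sum_mul_rpow_nonneg ha hf p) _

theorem powerMean_rpow (ha : ∀ x, 0 ≤ a x) (hf : ∀ x, 0 ≤ f x) (hp : 0 < p) :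
    powerMean a p f ^ p = ∑ x, a x * f x ^ p :=
  Real.rpow_inv_rpow (sum_mul_rpow_nonneg ha hf p) hp.ne'

theorem powerMean_const_mul (ha : ∀ x, 0 ≤ a x) (hf : ∀ x, 0 ≤ f x) (hp : 0 < p) {c : ℝ}
    (hc : 0 ≤ c) : powerMean a p (fun x => c * f x) = c * powerMean a p f := by
  unfold powerMean
  have h : ∑ x, a x * (c * f x) ^ p = c ^ p * ∑ x, a x * f x ^ p := by
    rw [Finset.mul_sum]
    refine Finset.sum_congr rfl fun x _ => ?_
    rw [Real.mul_rpow hc (hf x)]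
    ring
  rw [h, Real.mul_rpow (Real.rpow_nonneg hc p) (sum_mul_rpow_nonneg ha hf p),
    Real.rpow_rpow_inv hc hp.ne']

theorem powerMean_le_exp (ha : ∀ x, 0 ≤ a x) (hf : ∀ x, 0 ≤ f x) (hp : 0 < p) {s : ℝ}
    (h : ∑ x, a x * f x ^ p ≤ 1 + p * s) : powerMean a p f ≤ Real.exp s := by
  have h1 : ∑ x, a x * f x ^ p ≤ Real.exp (p * s) := by
    linarith [Real.add_one_le_exp (p * s)]
  calc powerMean a p f ≤ Real.exp (p * s) ^ p⁻¹ :=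
        Real.rpow_le_rpow (sum_mul_rpow_nonneg ha hf p) h1 (inv_nonneg.2 hp.le)
    _ = Real.exp s := by
        rw [← Real.exp_mul]
        congr 1
        field_simp

theorem powerMean_le_one (ha : a ∈ stdSimplex ℝ A) (hf : ∀ x, 0 ≤ f x)
    (hf1 : ∀ x, 0 < a x → f x ≤ 1) (hp : 0 < p) : powerMean a p f ≤ 1 := by
  rw [← Real.exp_zero]
  refine powerMean_le_exp ha.1 hf hp ?_
  rw [mul_zero, add_zero, ← ha.2]
  exact Finset.sum_le_sum fun x _ => mul_rpow_le_of_le_one ha.1 hf hf1 hp x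

/-- A function with a very small value on the support of the weights has a very small power mean,
if the order is small. -/
theorem powerMean_le_of_exists_small (ha : a ∈ stdSimplex ℝ A) (hf : ∀ x, 0 ≤ f x)
    (hf1 : ∀ x, 0 < a x → f x ≤ 1) (hp : 0 < p) {K m : ℝ} (hK : 0 < K) (hpK : p * K ≤ 1 / 2)
    {x₀ : A} (hx₀ : m ≤ a x₀) (hfx₀ : f x₀ ≤ Real.exp (-K)) :
    powerMean a p f ≤ Real.exp (-(m * K / 2)) := by
  classical
  have hpK0 : 0 < p * K := mul_pos hp hK
  have h1 : f x₀ ^ p ≤ 1 - p * K / 2 := by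
    calc f x₀ ^ p ≤ Real.exp (-K) ^ p := Real.rpow_le_rpow (hf x₀) hfx₀ hp.le
      _ = Real.exp (-(p * K)) := by rw [← Real.exp_mul]; congr 1; ring
      _ ≤ 1 - p * K / 2 := by
        have := abs_le.1 (Real.abs_exp_sub_one_sub_id_le (x := -(p * K))
          (by rw [abs_neg, abs_of_pos hpK0]; linarith))
        nlinarith [this.2]
  refine powerMean_le_exp ha.1 hf hp ?_
  rw [← ha.2, ← Finset.add_sum_erase _ _ (Finset.mem_univ x₀),
    ← Finset.add_sum_erase _ a (Finset.mem_univ x₀)]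
  have h2 : ∑ x ∈ Finset.univ.erase x₀, a x * f x ^ p ≤ ∑ x ∈ Finset.univ.erase x₀, a x :=
    Finset.sum_le_sum fun x _ => mul_rpow_le_of_le_one ha.1 hf hf1 hp x
  have h3 : a x₀ * f x₀ ^ p ≤ a x₀ * (1 - p * K / 2) :=
    mul_le_mul_of_nonneg_left h1 (ha.1 x₀)
  nlinarith [mul_le_mul_of_nonneg_right hx₀ hpK0.le]

/-- For functions bounded below on the support of the weights, the power mean of small order is
close to the geometric mean. -/
theorem powerMean_le_exp_sum_log (ha : a ∈ stdSimplex ℝ A) (hf : ∀ x, 0 ≤ f x)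
    (hf1 : ∀ x, 0 < a x → f x ≤ 1) (hp : 0 < p) {K : ℝ} (hpK : p * K ≤ 1 / 2)
    (hfK : ∀ x, 0 < a x → Real.exp (-K) ≤ f x) :
    powerMean a p f ≤ Real.exp (∑ x, a x * Real.log (f x) + p * K ^ 2) := by
  refine powerMean_le_exp ha.1 hf hp ?_
  have h : ∀ x, a x * f x ^ p ≤ a x * (1 + p * Real.log (f x) + (p * K) ^ 2) := by
    intro x
    rcases (ha.1 x).eq_or_lt with h0 | h0
    · simp [← h0]
    refine mul_le_mul_of_nonneg_left ?_ h0.le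
    have hfx : 0 < f x := (Real.exp_pos _).trans_le (hfK x h0)
    have hl0 : Real.log (f x) ≤ 0 := Real.log_nonpos hfx.le (hf1 x h0)
    have hlK : -K ≤ Real.log (f x) := (Real.le_log_iff_exp_le hfx).2 (hfK x h0)
    have h1 : -(p * K) ≤ p * Real.log (f x) := by nlinarith
    have h2 : p * Real.log (f x) ≤ 0 := mul_nonpos_of_nonneg_of_nonpos hp.le hl0
    rw [Real.rpow_def_of_pos hfx, mul_comm (Real.log _)]
    have := abs_le.1 (Real.abs_exp_sub_one_sub_id_le (x := p * Real.log (f x))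
      (abs_le.2 ⟨by linarith, by linarith⟩))
    nlinarith [this.2]
  calc ∑ x, a x * f x ^ p ≤ ∑ x, a x * (1 + p * Real.log (f x) + (p * K) ^ 2) :=
        Finset.sum_le_sum fun x _ => h x
    _ = (∑ x, a x) * (1 + (p * K) ^ 2) + p * ∑ x, a x * Real.log (f x) := by
        rw [Finset.sum_mul, Finset.mul_sum, ← Finset.sum_add_distrib]
        exact Finset.sum_congr rfl fun x _ => by ring
    _ = 1 + p * (∑ x, a x * Real.log (f x) + p * K ^ 2) := by rw [ha.2]; ring

/-- Uniformly over functions bounded by `1`, a power mean of small order is either tiny or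
essentially at most the geometric mean. -/
theorem eventually_powerMean_le_or (ha : a ∈ stdSimplex ℝ A) {q δ : ℝ} (hq : 0 < q) (hδ : 0 < δ) :
    ∀ᶠ p in 𝓝[>] (0 : ℝ), ∀ f : A → ℝ, (∀ x, 0 ≤ f x) → (∀ x, 0 < a x → f x ≤ 1) →
      powerMean a p f ≤ q ∨ ((∀ x, 0 < a x → 0 < f x) ∧
        powerMean a p f ≤ Real.exp (∑ x, a x * Real.log (f x) + δ)) := by
  obtain ⟨m, hm, hma⟩ : ∃ m > 0, ∀ x, 0 < a x → m ≤ a x := by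
    have h : ∀ x, ∀ᶠ m in 𝓝[>] (0 : ℝ), 0 < a x → m ≤ a x := fun x => by
      by_cases hx : 0 < a x
      · filter_upwards [Ioc_mem_nhdsGT hx] with m hm _ using hm.2
      · exact Eventually.of_forall fun m h => absurd h hx
    obtain ⟨m, h1, h2⟩ := ((eventually_all.2 h).and self_mem_nhdsWithin).exists
    exact ⟨m, h2, h1⟩
  -- `K` is large enough that a value below `exp (-K)` makes the power mean at most `q`.
  set K : ℝ := 1 + 2 * |Real.log q| / m with hKdef
  have hK : 0 < K := by positivity
  have hKq : Real.exp (-(m * K / 2)) ≤ q := by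
    rw [← Real.le_log_iff_exp_le hq]
    have : m * K / 2 = m / 2 + |Real.log q| := by rw [hKdef]; field_simp
    linarith [neg_abs_le (Real.log q)]
  have hp1 : 0 < 1 / 2 / K := by positivity
  have hp2 : 0 < δ / K ^ 2 := by positivity
  filter_upwards [self_mem_nhdsWithin, Ioc_mem_nhdsGT hp1, Ioc_mem_nhdsGT hp2] with p hp h1 h2 f hf hf1
  have hp : 0 < p := hp
  have h1 : p * K ≤ 1 / 2 := (le_div_iff₀ hK).1 h1.2
  have h2 : p * K ^ 2 ≤ δ := (le_div_iff₀ (by positivity)).1 h2.2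
  by_cases hx : ∃ x, 0 < a x ∧ f x ≤ Real.exp (-K)
  · obtain ⟨x, hx, hfx⟩ := hx
    exact Or.inl ((powerMean_le_of_exists_small ha hf hf1 hp hK h1 (hma x hx) hfx).trans hKq)
  · push Not at hx
    refine Or.inr ⟨fun x h => (Real.exp_pos _).trans (hx x h), ?_⟩
    refine (powerMean_le_exp_sum_log ha hf hf1 hp h1 fun x h => (hx x h).le).trans ?_
    exact Real.exp_le_exp.2 (by linarith)

/-- Normalization to maximum `1` on the support of the weights. -/
theorem powerMean_eq_zero_or_exists_normalization (ha : a ∈ stdSimplex ℝ A) (hf : ∀ x, 0 ≤ f x) :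
    (∀ p, 0 < p → powerMean a p f = 0) ∨
      ∃ M > 0, ∃ g : A → ℝ, (∀ x, 0 ≤ g x) ∧ (∀ x, 0 < a x → g x ≤ 1) ∧ (∃ x, g x = 1) ∧
        f = fun x => M * g x := by
  classical
  have hne : (Finset.univ.filter fun x => 0 < a x).Nonempty := by
    by_contra h
    rw [Finset.not_nonempty_iff_eq_empty, Finset.filter_eq_empty_iff] at h
    have : ∑ x, a x = 0 :=
      Finset.sum_eq_zero fun x hx => le_antisymm (not_lt.1 (h hx)) (ha.1 x)
    exact zero_ne_one (this.symm.trans ha.2)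
  obtain ⟨x₀, hx₀, hmax⟩ := Finset.exists_max_image _ f hne
  simp only [Finset.mem_filter, Finset.mem_univ, true_and] at hx₀ hmax
  rcases (hf x₀).eq_or_lt with h | h
  · left
    intro p hp
    have hsum : ∑ x, a x * f x ^ p = 0 := by
      refine Finset.sum_eq_zero fun x _ => ?_
      rcases (ha.1 x).eq_or_lt with h' | h'
      · simp [← h']
      · rw [le_antisymm ((hmax x h').trans h.ge) (hf x), Real.zero_rpow hp.ne', mul_zero]
    rw [powerMean, hsum, Real.zero_rpow (inv_ne_zero hp.ne')]
  · right
    refine ⟨f x₀, h, fun x => f x / f x₀, fun x => div_nonneg (hf x) h.le,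
      fun x hx => (div_le_one h).2 (hmax x hx), ⟨x₀, div_self h.ne'⟩, ?_⟩
    funext x
    field_simp

end PowerMean

/-! ### The reverse Brascamp-Lieb inequality and rectangles -/

section ReverseBrascampLieb

variable {Z A B C : Type*}

theorem comp_finCons {n : ℕ} (π : Z → A) (z₀ : Z) (z : Fin n → Z) :
    (fun t => π ((Fin.cons z₀ z : Fin (n + 1) → Z) t)) =
      (Fin.cons (π z₀) fun t => π (z t) : Fin (n + 1) → A) := by
  funext t
  refine Fin.cases ?_ (fun t => ?_) t <;> simp

variable [Fintype Z] [Fintype A] [Fintype B] [Fintype C]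

/-- Gibbs variational principle: `log ∑ q F ≥ ∑ p log F - D(p‖q)`. -/
theorem exp_sum_sub_relEntropy_le {p q : Z → ℝ} (hp : p ∈ stdSimplex ℝ Z) (hq : ∀ z, 0 < q z)
    {F : Z → ℝ} (hF : ∀ z, 0 ≤ F z) (hFp : ∀ z, 0 < p z → 0 < F z) :
    Real.exp (∑ z, p z * Real.log (F z) - relEntropy p q) ≤ ∑ z, q z * F z := by
  have h1 : ∑ z, p z * Real.log (F z) - relEntropy p q
      = ∑ z, p z • Real.log (q z * F z / p z) := by
    rw [relEntropy, ← Finset.sum_sub_distrib]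
    refine Finset.sum_congr rfl fun z _ => ?_
    rcases (hp.1 z).eq_or_lt with h | h
    · simp [← h]
    · rw [smul_eq_mul, Real.log_div h.ne' (hq z).ne',
        Real.log_div (mul_pos (hq z) (hFp z h)).ne' h.ne',
        Real.log_mul (hq z).ne' (hFp z h).ne']
      ring
  rw [h1]
  refine (convexOn_exp.map_sum_le (fun z _ => hp.1 z) hp.2 fun z _ => Set.mem_univ _).trans ?_
  refine Finset.sum_le_sum fun z _ => ?_
  rcases (hp.1 z).eq_or_lt with h | h
  · simpa [← h] using mul_nonneg (hq z).le (hF z)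
  · rw [smul_eq_mul, Real.exp_log (div_pos (mul_pos (hq z) (hFp z h)) h)]
    exact (mul_div_cancel₀ _ h.ne').le

/-- A reverse Brascamp-Lieb inequality: in the limit of power means of order zero this is the Gibbs
variational principle for functions of product form, and the loss for a small positive order is
uniform over all functions. Positivity of `Q` handles functions that are tiny on the support of
the marginals: their power means are tiny too, while the left side is at least the smallest weight
of `Q` once the maxima are normalized to `1`. -/
theorem exists_reverse_brascamp_lieb (Pt Q : PMF Z) (hQ : ∀ z, 0 < Q z)
    (πA : Z → A) (πB : Z → B) (πC : Z → C)
    (hsurj : ∀ x y w, ∃ z, πA z = x ∧ πB z = y ∧ πC z = w) {δ : ℝ} (hδ : 0 < δ) :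
    ∃ p > 0, ∀ (f : A → ℝ) (g : B → ℝ) (h : C → ℝ), (∀ x, 0 ≤ f x) → (∀ y, 0 ≤ g y) →
      (∀ w, 0 ≤ h w) →
      Real.exp (-(relEntropy Pt.toRealFun Q.toRealFun + δ)) *
        (powerMean (Pt.map πA).toRealFun p f * powerMean (Pt.map πB).toRealFun p g *
          powerMean (Pt.map πC).toRealFun p h) ≤
        ∑ z, Q.toRealFun z * (f (πA z) * g (πB z) * h (πC z)) := by
  set D := relEntropy Pt.toRealFun Q.toRealFun
  have hQ' : ∀ z, 0 < Q.toRealFun z := fun z => PMF.toRealFun_pos (hQ z)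
  obtain ⟨m, hm, hmQ⟩ : ∃ m > 0, ∀ z, m ≤ Q.toRealFun z := by
    have hne : Nonempty Z := Q.support_nonempty.to_type
    obtain ⟨z₀, hz₀⟩ := Finite.exists_min Q.toRealFun
    exact ⟨_, hQ' z₀, hz₀⟩
  have ha := (Pt.map πA).toRealFun_mem_stdSimplex
  have hb := (Pt.map πB).toRealFun_mem_stdSimplex
  have hc := (Pt.map πC).toRealFun_mem_stdSimplex
  set a := (Pt.map πA).toRealFun with ha_def
  set b := (Pt.map πB).toRealFun with hb_def
  set c := (Pt.map πC).toRealFun with hc_def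
  have hm' : 0 < m * Real.exp (D + δ) := by positivity
  have hδ3 : 0 < δ / 3 := by positivity
  obtain ⟨p, ⟨⟨⟨hpa, hpb⟩, hpc⟩, hp⟩⟩ := ((((eventually_powerMean_le_or ha hm' hδ3).and
    (eventually_powerMean_le_or hb hm' hδ3)).and (eventually_powerMean_le_or hc hm' hδ3)).and
    self_mem_nhdsWithin).exists
  have hp : 0 < p := hp
  refine ⟨p, hp, ?_⟩
  have key : ∀ (f : A → ℝ) (g : B → ℝ) (h : C → ℝ), (∀ x, 0 ≤ f x) → (∀ y, 0 ≤ g y) →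
      (∀ w, 0 ≤ h w) → (∀ x, 0 < a x → f x ≤ 1) → (∀ x, 0 < b x → g x ≤ 1) →
      (∀ x, 0 < c x → h x ≤ 1) → (∃ x, f x = 1) → (∃ x, g x = 1) → (∃ x, h x = 1) →
      Real.exp (-(D + δ)) * (powerMean a p f * powerMean b p g * powerMean c p h) ≤
        ∑ z, Q.toRealFun z * (f (πA z) * g (πB z) * h (πC z)) := by
    intro f g h hf hg hh hf1 hg1 hh1 ⟨x, hx⟩ ⟨y, hy⟩ ⟨w, hw⟩
    have hNf := powerMean_nonneg ha.1 hf p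
    have hNg := powerMean_nonneg hb.1 hg p
    have hNh := powerMean_nonneg hc.1 hh p
    have hNf1 := powerMean_le_one ha hf hf1 hp
    have hNg1 := powerMean_le_one hb hg hg1 hp
    have hNh1 := powerMean_le_one hc hh hh1 hp
    have hF : ∀ z, 0 ≤ f (πA z) * g (πB z) * h (πC z) := fun z =>
      mul_nonneg (mul_nonneg (hf _) (hg _)) (hh _)
    -- It suffices that the product of the power means is small: the point over the three maximizers
    -- contributes at least `m` to the right side.
    have small : powerMean a p f * powerMean b p g * powerMean c p h ≤ m * Real.exp (D + δ) →
        Real.exp (-(D + δ)) * (powerMean a p f * powerMean b p g * powerMean c p h) ≤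
        ∑ z, Q.toRealFun z * (f (πA z) * g (πB z) * h (πC z)) := by
      intro hs
      obtain ⟨z, hz1, hz2, hz3⟩ := hsurj x y w
      calc _ ≤ Real.exp (-(D + δ)) * (m * Real.exp (D + δ)) :=
            mul_le_mul_of_nonneg_left hs (Real.exp_pos _).le
        _ = m := by rw [Real.exp_neg]; field_simp
        _ ≤ Q.toRealFun z * (f (πA z) * g (πB z) * h (πC z)) := by
            rw [hz1, hz2, hz3, hx, hy, hw]; simpa using hmQ z
        _ ≤ _ := Finset.single_le_sum (f := fun z => Q.toRealFun z *
            (f (πA z) * g (πB z) * h (πC z)))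
            (fun z _ => mul_nonneg (hQ' z).le (hF z)) (Finset.mem_univ z)
    have hfg1 : powerMean a p f * powerMean b p g ≤ 1 := mul_le_one₀ hNf1 hNg hNg1
    rcases hpa f hf hf1 with h1 | ⟨hf0, h1⟩
    · refine small ((mul_le_of_le_one_right (by positivity) hNh1).trans ?_)
      exact (mul_le_of_le_one_right hNf hNg1).trans h1
    rcases hpb g hg hg1 with h2 | ⟨hg0, h2⟩
    · refine small ((mul_le_of_le_one_right (by positivity) hNh1).trans ?_)
      exact (mul_le_of_le_one_left hNg hNf1).trans h2
    rcases hpc h hh hh1 with h3 | ⟨hh0, h3⟩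
    · exact small ((mul_le_of_le_one_left hNh hfg1).trans h3)
    have hpos : ∀ z, 0 < Pt.toRealFun z →
        0 < f (πA z) ∧ 0 < g (πB z) ∧ 0 < h (πC z) :=
      fun z hz => ⟨hf0 _ (PMF.toRealFun_map_pos πA hz), hg0 _ (PMF.toRealFun_map_pos πB hz),
        hh0 _ (PMF.toRealFun_map_pos πC hz)⟩
    refine le_trans ?_ (exp_sum_sub_relEntropy_le Pt.toRealFun_mem_stdSimplex hQ' hF fun z hz =>
      mul_pos (mul_pos (hpos z hz).1 (hpos z hz).2.1) (hpos z hz).2.2)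
    have hlog : ∑ z, Pt.toRealFun z * Real.log (f (πA z) * g (πB z) * h (πC z)) =
        ∑ x, a x * Real.log (f x) + ∑ y, b y * Real.log (g y) + ∑ w, c w * Real.log (h w) := by
      rw [ha_def, hb_def, hc_def, Pt.sum_toRealFun_map πA fun x => Real.log (f x),
        Pt.sum_toRealFun_map πB fun x => Real.log (g x),
        Pt.sum_toRealFun_map πC fun x => Real.log (h x), ← Finset.sum_add_distrib,
        ← Finset.sum_add_distrib]
      refine Finset.sum_congr rfl fun z _ => ?_
      rcases (Pt.toRealFun_nonneg z).eq_or_lt with h0 | h0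
      · simp [← h0]
      · obtain ⟨i, j, k⟩ := hpos z h0
        rw [Real.log_mul (mul_pos i j).ne' k.ne', Real.log_mul i.ne' j.ne']
        ring
    rw [hlog]
    calc _ ≤ Real.exp (-(D + δ)) * (Real.exp (∑ x, a x * Real.log (f x) + δ / 3) *
          Real.exp (∑ y, b y * Real.log (g y) + δ / 3) *
          Real.exp (∑ w, c w * Real.log (h w) + δ / 3)) := by gcongr
      _ = _ := by
        rw [← Real.exp_add, ← Real.exp_add, ← Real.exp_add]
        congr 1
        ring
  intro f g h hf hg hh
  have hrhs : 0 ≤ ∑ z, Q.toRealFun z * (f (πA z) * g (πB z) * h (πC z)) :=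
    Finset.sum_nonneg fun z _ => mul_nonneg (hQ' z).le
      (mul_nonneg (mul_nonneg (hf _) (hg _)) (hh _))
  rcases powerMean_eq_zero_or_exists_normalization ha hf with
    h0 | ⟨M₁, hM₁, f', hf', hf1, hfx, rfl⟩
  · simpa [h0 p hp] using hrhs
  rcases powerMean_eq_zero_or_exists_normalization hb hg with
    h0 | ⟨M₂, hM₂, g', hg', hg1, hgx, rfl⟩
  · simpa [h0 p hp] using hrhs
  rcases powerMean_eq_zero_or_exists_normalization hc hh with
    h0 | ⟨M₃, hM₃, h', hh', hh1, hhx, rfl⟩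
  · simpa [h0 p hp] using hrhs
  rw [powerMean_const_mul ha.1 hf' hp hM₁.le, powerMean_const_mul hb.1 hg' hp hM₂.le,
    powerMean_const_mul hc.1 hh' hp hM₃.le]
  have := mul_le_mul_of_nonneg_left (key f' g' h' hf' hg' hh' hf1 hg1 hh1 hfx hgx hhx)
    (mul_pos (mul_pos hM₁ hM₂) hM₃).le
  rw [Finset.mul_sum] at this
  refine (le_of_eq (by ring)).trans (this.trans (le_of_eq ?_))
  exact Finset.sum_congr rfl fun z _ => by ring

theorem sum_fin_succ_fun {n : ℕ} (φ : (Fin (n + 1) → Z) → ℝ) :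
    ∑ z, φ z = ∑ z₀, ∑ z : Fin n → Z, φ (Fin.cons z₀ z) := by
  rw [← Fintype.sum_prod_type', ← (Fin.consEquiv fun _ => Z).sum_comp]
  rfl

/-- A power mean with product weights is an iterated power mean. -/
theorem powerMean_prod_succ {n : ℕ} {a : A → ℝ} (ha : ∀ x, 0 ≤ a x) {p : ℝ} (hp : 0 < p)
    {F : (Fin (n + 1) → A) → ℝ} (hF : ∀ x, 0 ≤ F x) :
    powerMean (fun x => ∏ t, a (x t)) p F =
      powerMean a p fun x₀ => powerMean (fun x : Fin n → A => ∏ t, a (x t)) p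
        fun x => F (Fin.cons x₀ x) := by
  conv_rhs => rw [powerMean]
  rw [powerMean, sum_fin_succ_fun]
  congr 1
  refine Finset.sum_congr rfl fun x₀ _ => ?_
  rw [powerMean_rpow (fun x => Finset.prod_nonneg fun t _ => ha _) (fun x => hF _) hp,
    Finset.mul_sum]
  refine Finset.sum_congr rfl fun x _ => ?_
  rw [Fin.prod_univ_succ, mul_assoc]
  simp

/-- Reverse Brascamp-Lieb inequalities tensorize. -/
theorem reverse_brascamp_lieb_tensorize {q : Z → ℝ} (hq : ∀ z, 0 ≤ q z)
    {πA : Z → A} {πB : Z → B} {πC : Z → C} {a : A → ℝ} {b : B → ℝ} {c : C → ℝ}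
    (ha : ∀ x, 0 ≤ a x) (hb : ∀ y, 0 ≤ b y) (hc : ∀ w, 0 ≤ c w) {p : ℝ} (hp : 0 < p) {κ : ℝ}
    (hκ : 0 ≤ κ)
    (H : ∀ (f : A → ℝ) (g : B → ℝ) (h : C → ℝ), (∀ x, 0 ≤ f x) → (∀ y, 0 ≤ g y) →
      (∀ w, 0 ≤ h w) → κ * (powerMean a p f * powerMean b p g * powerMean c p h) ≤
        ∑ z, q z * (f (πA z) * g (πB z) * h (πC z))) (n : ℕ) :
    ∀ (f : (Fin n → A) → ℝ) (g : (Fin n → B) → ℝ) (h : (Fin n → C) → ℝ), (∀ x, 0 ≤ f x) →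
      (∀ y, 0 ≤ g y) → (∀ w, 0 ≤ h w) →
      κ ^ n * (powerMean (fun x => ∏ t, a (x t)) p f * powerMean (fun y => ∏ t, b (y t)) p g *
        powerMean (fun w => ∏ t, c (w t)) p h) ≤
        ∑ z : Fin n → Z, (∏ t, q (z t)) *
          (f (fun t => πA (z t)) * g (fun t => πB (z t)) * h (fun t => πC (z t))) := by
  induction n with
  | zero =>
    intro f g h hf hg hh
    simp only [powerMean, Finset.univ_unique, Finset.sum_singleton, Finset.univ_eq_empty,
      Finset.prod_empty, one_mul, pow_zero]
    rw [Real.rpow_rpow_inv (hf _) hp.ne', Real.rpow_rpow_inv (hg _) hp.ne',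
      Real.rpow_rpow_inv (hh _) hp.ne']
    apply le_of_eq
    congr 1 <;> congr 1 <;> congr 1 <;> exact Subsingleton.elim _ _
  | succ n ih =>
    intro f g h hf hg hh
    rw [powerMean_prod_succ ha hp hf, powerMean_prod_succ hb hp hg, powerMean_prod_succ hc hp hh,
      sum_fin_succ_fun]
    have ha' : ∀ x : Fin n → A, 0 ≤ ∏ t, a (x t) := fun x => Finset.prod_nonneg fun t _ => ha _
    have hb' : ∀ x : Fin n → B, 0 ≤ ∏ t, b (x t) := fun x => Finset.prod_nonneg fun t _ => hb _
    have hc' : ∀ x : Fin n → C, 0 ≤ ∏ t, c (x t) := fun x => Finset.prod_nonneg fun t _ => hc _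
    refine (le_of_eq (by rw [pow_succ, mul_assoc])).trans
      ((mul_le_mul_of_nonneg_left (H _ _ _ (fun x => powerMean_nonneg ha' (fun _ => hf _) p)
      (fun y => powerMean_nonneg hb' (fun _ => hg _) p)
      (fun w => powerMean_nonneg hc' (fun _ => hh _) p)) (pow_nonneg hκ n)).trans ?_)
    rw [Finset.mul_sum]
    refine Finset.sum_le_sum fun z₀ _ => ?_
    have := mul_le_mul_of_nonneg_left (ih (fun x => f (Fin.cons (πA z₀) x))
      (fun y => g (Fin.cons (πB z₀) y)) (fun w => h (Fin.cons (πC z₀) w)) (fun _ => hf _)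
      (fun _ => hg _) (fun _ => hh _)) (hq z₀)
    refine (le_of_eq (by ring)).trans (this.trans (le_of_eq ?_))
    rw [Finset.mul_sum]
    refine Finset.sum_congr rfl fun z _ => ?_
    rw [Fin.prod_univ_succ, comp_finCons, comp_finCons, comp_finCons]
    simp [mul_assoc]

open Classical in
theorem rpow_inv_le_powerMean_indicator [MeasurableSpace A] [MeasurableSingletonClass A]
    (R : PMF A) {p : ℝ} (hp : 0 < p) {n : ℕ} {S : Set (Fin n → A)} {ε : ℝ} (hε : 0 ≤ ε)
    (h : ENNReal.ofReal ε ≤ iidLaw R n S) :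
    ε ^ p⁻¹ ≤ powerMean (fun x => ∏ t, R.toRealFun (x t)) p fun x => if x ∈ S then 1 else 0 := by
  rw [iidLaw_apply, ENNReal.ofReal_le_ofReal_iff] at h
  · refine Real.rpow_le_rpow hε (h.trans (le_of_eq ?_)) (inv_nonneg.2 hp.le)
    refine Finset.sum_congr rfl fun x _ => ?_
    by_cases hx : x ∈ S <;> simp [hx, hp.ne']
  · exact Finset.sum_nonneg fun x _ => mul_nonneg
      (Finset.prod_nonneg fun t _ => R.toRealFun_nonneg _) (by split_ifs <;> norm_num)

/-- If three sets have probability at least `ε` under the marginals of `Pt`, the probability under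
`Q` of the rectangle they span decays at most at the exponential rate `D(Pt‖Q)`. -/
theorem exists_iidLaw_rectangle_ge [MeasurableSpace Z] [MeasurableSpace A] [MeasurableSpace B]
    [MeasurableSpace C] [MeasurableSingletonClass Z] [MeasurableSingletonClass A]
    [MeasurableSingletonClass B] [MeasurableSingletonClass C]
    (Pt Q : PMF Z) (hQ : ∀ z, 0 < Q z) (πA : Z → A) (πB : Z → B) (πC : Z → C)
    (hsurj : ∀ x y w, ∃ z, πA z = x ∧ πB z = y ∧ πC z = w) {δ ε : ℝ} (hδ : 0 < δ) (hε : 0 < ε) :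
    ∃ r > 0, ∀ (n : ℕ) (S : Set (Fin n → A)) (T : Set (Fin n → B)) (U : Set (Fin n → C)),
      ENNReal.ofReal ε ≤ iidLaw (Pt.map πA) n S → ENNReal.ofReal ε ≤ iidLaw (Pt.map πB) n T →
      ENNReal.ofReal ε ≤ iidLaw (Pt.map πC) n U →
      ENNReal.ofReal (Real.exp (-(n * (relEntropy Pt.toRealFun Q.toRealFun + δ))) * r) ≤
        iidLaw Q n {z | (fun t => πA (z t)) ∈ S ∧ (fun t => πB (z t)) ∈ T ∧
          (fun t => πC (z t)) ∈ U} := by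
  classical
  obtain ⟨p, hp, H⟩ := exists_reverse_brascamp_lieb Pt Q hQ πA πB πC hsurj hδ
  refine ⟨ε ^ p⁻¹ * ε ^ p⁻¹ * ε ^ p⁻¹, by positivity, fun n S T U hS hT hU => ?_⟩
  have h01 : ∀ (P : Prop), (0 : ℝ) ≤ if P then 1 else 0 := fun P => by split_ifs <;> norm_num
  have hite : ∀ P₁ P₂ P₃ : Prop, (if P₁ then (1 : ℝ) else 0) * (if P₂ then 1 else 0) *
      (if P₃ then 1 else 0) = if P₁ ∧ P₂ ∧ P₃ then 1 else 0 := fun P₁ P₂ P₃ => by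
    by_cases h₁ : P₁ <;> by_cases h₂ : P₂ <;> by_cases h₃ : P₃ <;> simp [h₁, h₂, h₃]
  have key := reverse_brascamp_lieb_tensorize Q.toRealFun_nonneg (Pt.map πA).toRealFun_nonneg
    (Pt.map πB).toRealFun_nonneg (Pt.map πC).toRealFun_nonneg hp (Real.exp_pos _).le H n
    (fun x => if x ∈ S then 1 else 0) (fun y => if y ∈ T then 1 else 0)
    (fun w => if w ∈ U then 1 else 0) (fun _ => h01 _) (fun _ => h01 _) (fun _ => h01 _)
  have h1 := rpow_inv_le_powerMean_indicator _ hp hε.le hS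
  have h2 := rpow_inv_le_powerMean_indicator _ hp hε.le hT
  have h3 := rpow_inv_le_powerMean_indicator _ hp hε.le hU
  rw [iidLaw_apply]
  refine ENNReal.ofReal_le_ofReal ?_
  have hε' : 0 < ε ^ p⁻¹ := Real.rpow_pos_of_pos hε _
  calc _ = Real.exp (-(relEntropy Pt.toRealFun Q.toRealFun + δ)) ^ n *
        (ε ^ p⁻¹ * ε ^ p⁻¹ * ε ^ p⁻¹) := by
        rw [← Real.exp_nat_mul, mul_neg]
    _ ≤ _ := by
        refine le_trans ?_ key
        refine mul_le_mul_of_nonneg_left ?_ (by positivity)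
        have h4 := hε'.le.trans h1
        have h5 := hε'.le.trans h2
        exact mul_le_mul (mul_le_mul h1 h2 hε'.le h4) h3 hε'.le (mul_nonneg h4 h5)
    _ = _ := by
        refine Finset.sum_congr rfl fun z _ => ?_
        rw [hite]
        congr

end ReverseBrascampLieb

/-- A sequence bounded below by `exp (-n d)`, up to a constant factor, has exponent at most `d`. -/
theorem errorExponent_le_of_le {β : ℕ → ℝ≥0∞} {d r : ℝ} (hr : 0 < r)
    (h : ∀ᶠ n : ℕ in atTop, ENNReal.ofReal (Real.exp (-(n * d)) * r) ≤ β n) :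
    errorExponent β ≤ d := by
  have hlim : Tendsto (fun n : ℕ => (((d - Real.log r / n : ℝ)) : EReal)) atTop (𝓝 (d : EReal)) := by
    refine (continuous_coe_real_ereal.tendsto d).comp ?_
    simpa using tendsto_const_nhds.sub (tendsto_const_div_atTop_nhds_zero_nat (Real.log r))
  refine (liminf_le_liminf ?_).trans_eq hlim.liminf_eq
  filter_upwards [h, eventually_gt_atTop 0] with n hn hn0
  have hn0' : (0 : ℝ) < n := Nat.cast_pos.2 hn0
  have hpos : 0 < Real.exp (-(n * d)) * r := by positivity
  rw [EReal.div_le_iff_le_mul (by exact_mod_cast hn0) (EReal.natCast_ne_top n), EReal.neg_le]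
  have h1 := ENNReal.log_monotone hn
  rw [ENNReal.log_pos_real' (by rwa [ENNReal.toReal_ofReal hpos.le]),
    ENNReal.toReal_ofReal hpos.le, Real.log_mul (Real.exp_pos _).ne' hr.ne', Real.log_exp] at h1
  refine le_trans (le_of_eq ?_) h1
  rw [← EReal.coe_natCast, ← EReal.coe_mul, ← EReal.coe_neg]
  congr 1
  field_simp
  ring

/-! ### Minimal relative entropy under linear constraints -/

section LinearConstraints

variable {Z J : Type*} [Fintype Z]

/-- The weight vectors in the simplex under which the features `u j` have expectations `c j`. -/
def linearFamily (u : J → Z → ℝ) (c : J → ℝ) : Set (Z → ℝ) :=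
  {p | p ∈ stdSimplex ℝ Z ∧ ∀ j, ∑ z, p z * u j z = c j}

theorem continuous_sum_mul (v : Z → ℝ) : Continuous fun p : Z → ℝ => ∑ z, p z * v z :=
  continuous_finsetSum _ fun z _ => (continuous_apply z).mul continuous_const

theorem isCompact_linearFamily (u : J → Z → ℝ) (c : J → ℝ) : IsCompact (linearFamily u c) := by
  refine (isCompact_stdSimplex ℝ Z).inter_right (t := {p | ∀ j, ∑ z, p z * u j z = c j}) ?_
  simp only [Set.ofPred_forall]
  exact isClosed_iInter fun j => isClosed_eq (continuous_sum_mul _) continuous_const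

theorem exists_relEntropy_min {q : Z → ℝ} (hq : ∀ z, 0 < q z) {u : J → Z → ℝ} {c : J → ℝ}
    (hne : (linearFamily u c).Nonempty) :
    ∃ p ∈ linearFamily u c, ∀ p' ∈ linearFamily u c, relEntropy p q ≤ relEntropy p' q :=
  (isCompact_linearFamily u c).exists_isMinOn hne (continuous_relEntropy hq).continuousOn

/-- The minimal relative entropy is lower semicontinuous in the constraints. -/
theorem exists_relEntropy_gt_of_near [Finite J] {q : Z → ℝ} (hq : ∀ z, 0 < q z) {u : J → Z → ℝ}
    {c : J → ℝ} {D d : ℝ} (hD : ∀ p ∈ linearFamily u c, D ≤ relEntropy p q) (hd : d < D) :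
    ∃ μ > 0, ∀ p ∈ stdSimplex ℝ Z, (∀ j, |∑ z, p z * u j z - c j| ≤ μ) → d < relEntropy p q := by
  cases nonempty_fintype J
  -- On the compact set `K` where the relative entropy is at most `d`, the total violation of the
  -- constraints is positive, hence bounded away from zero.
  set K : Set (Z → ℝ) := {p | p ∈ stdSimplex ℝ Z ∧ relEntropy p q ≤ d} with hK
  have hKc : IsCompact K := (isCompact_stdSimplex ℝ Z).inter_right (t := {p | relEntropy p q ≤ d})
    (isClosed_le (continuous_relEntropy hq) continuous_const)
  have hcont : Continuous fun p : Z → ℝ => ∑ j, |∑ z, p z * u j z - c j| :=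
    continuous_finsetSum _ fun j _ => ((continuous_sum_mul _).sub continuous_const).abs
  rcases K.eq_empty_or_nonempty with h | h
  · refine ⟨1, one_pos, fun p hp _ => ?_⟩
    by_contra hlt
    exact (h ▸ (⟨hp, not_lt.1 hlt⟩ : p ∈ K) : p ∈ (∅ : Set (Z → ℝ)))
  obtain ⟨p₀, hp₀, hmin⟩ := hKc.exists_isMinOn h hcont.continuousOn
  have hpos : 0 < ∑ j, |∑ z, p₀ z * u j z - c j| := by
    refine (Finset.sum_nonneg fun j _ => abs_nonneg _).lt_of_ne' fun h0 => ?_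
    rw [Finset.sum_eq_zero_iff_of_nonneg fun j _ => abs_nonneg _] at h0
    have := hD p₀ ⟨hp₀.1, fun j => sub_eq_zero.1 (abs_eq_zero.1 (h0 j (Finset.mem_univ j)))⟩
    linarith [hp₀.2]
  set s := ∑ j, |∑ z, p₀ z * u j z - c j|
  refine ⟨s / (Fintype.card J + 1), by positivity, fun p hp hpj => ?_⟩
  by_contra hlt
  have h1 : s ≤ ∑ j, |∑ z, p z * u j z - c j| := hmin (⟨hp, not_lt.1 hlt⟩ : p ∈ K)
  have h2 : ∑ j, |∑ z, p z * u j z - c j| ≤ Fintype.card J * (s / (Fintype.card J + 1)) := by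
    refine (Finset.sum_le_sum fun j _ => hpj j).trans_eq ?_
    rw [Finset.sum_const, nsmul_eq_mul, Finset.card_univ]
  have h3 : (Fintype.card J : ℝ) * (s / (Fintype.card J + 1)) < s := by
    rw [mul_div_assoc', div_lt_iff₀ (by positivity)]
    linarith
  linarith

end LinearConstraints

/-! ### Probabilities of sets with nearly fixed empirical averages -/

section EmpiricalAverage

variable {Z J : Type*}

/-- The sequences whose empirical averages of the features `u j` are within `μ` of `c j`. -/
def nearConstraints (u : J → Z → ℝ) (c : J → ℝ) (μ : ℝ) (n : ℕ) : Set (Fin n → Z) :=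
  {w | ∀ j, |(∑ t, u j (w t)) / n - c j| ≤ μ}

theorem nearConstraints_mono (u : J → Z → ℝ) (c : J → ℝ) {μ ν : ℝ} (h : μ ≤ ν) (n : ℕ) :
    nearConstraints u c μ n ⊆ nearConstraints u c ν n :=
  fun _ hw j => (hw j).trans h

open Classical in
/-- The weights averaged over time of the i.i.d. law of `q` conditioned on `E`: the value at `a` is
the conditional expectation of the empirical frequency of `a`. -/
noncomputable def averageConditional (q : Z → ℝ) (n : ℕ) (E : Finset (Fin n → Z)) (a : Z) : ℝ :=
  (∑ w ∈ E, ∏ t, q (w t))⁻¹ *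
    ∑ w ∈ E, (∏ t, q (w t)) * ((∑ t, if w t = a then 1 else 0) / n)

variable {q : Z → ℝ} {n : ℕ} {E : Finset (Fin n → Z)}

theorem averageConditional_pos (hq : ∀ z, 0 < q z) {w : Fin n → Z} (hw : w ∈ E) (t : Fin n) :
    0 < averageConditional q n E (w t) := by
  classical
  have hn : (0 : ℝ) < n := Nat.cast_pos.2 t.pos
  have h01 : ∀ (P : Prop), (0 : ℝ) ≤ if P then 1 else 0 := fun P => by split_ifs <;> norm_num
  refine mul_pos (inv_pos.2 (Finset.sum_pos (fun w _ => Finset.prod_pos fun t _ => hq _) ⟨w, hw⟩)) ?_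
  refine Finset.sum_pos' (fun w _ => mul_nonneg (Finset.prod_nonneg fun t _ => (hq _).le)
    (div_nonneg (Finset.sum_nonneg fun t _ => h01 _) hn.le)) ⟨w, hw, ?_⟩
  refine mul_pos (Finset.prod_pos fun t _ => hq _) (div_pos ?_ hn)
  refine Finset.sum_pos' (fun t _ => h01 _) ⟨t, Finset.mem_univ t, by simp⟩

variable [Fintype Z]

theorem sum_prod_eq_one {p : Z → ℝ} (hp : ∑ z, p z = 1) (n : ℕ) :
    ∑ z : Fin n → Z, ∏ t, p (z t) = 1 := by
  classical
  have := Finset.prod_univ_sum (fun _ : Fin n => (Finset.univ : Finset Z)) fun _ z => p z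
  rw [Fintype.piFinset_univ] at this
  rw [← this, hp, Finset.prod_const_one]

/-- The expectation of `v` under the averaged law is the conditional expectation of its empirical
average. -/
theorem sum_averageConditional_mul (v : Z → ℝ) :
    ∑ a, averageConditional q n E a * v a =
      (∑ w ∈ E, ∏ t, q (w t))⁻¹ * ∑ w ∈ E, (∏ t, q (w t)) * ((∑ t, v (w t)) / n) := by
  classical
  simp only [averageConditional, mul_assoc]
  rw [← Finset.mul_sum]
  congr 1
  simp_rw [Finset.sum_mul]
  rw [Finset.sum_comm]
  refine Finset.sum_congr rfl fun w _ => ?_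
  simp_rw [mul_assoc]
  rw [← Finset.mul_sum]
  congr 1
  simp_rw [div_mul_eq_mul_div]
  rw [← Finset.sum_div]
  congr 1
  simp_rw [Finset.sum_mul]
  rw [Finset.sum_comm]
  simp

theorem averageConditional_mem_stdSimplex (hq : ∀ z, 0 < q z) (hn : 0 < n) (hE : E.Nonempty) :
    averageConditional q n E ∈ stdSimplex ℝ Z := by
  have hpos : 0 < ∑ w ∈ E, ∏ t, q (w t) :=
    Finset.sum_pos (fun w _ => Finset.prod_pos fun t _ => hq _) hE
  refine ⟨fun a => ?_, ?_⟩
  · refine mul_nonneg (inv_nonneg.2 hpos.le) (Finset.sum_nonneg fun w _ => mul_nonneg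
      (Finset.prod_nonneg fun t _ => (hq _).le) (div_nonneg (Finset.sum_nonneg fun t _ => ?_)
        (Nat.cast_nonneg n)))
    split_ifs <;> norm_num
  · have hn' : (n : ℝ) ≠ 0 := by positivity
    have := sum_averageConditional_mul (q := q) (n := n) (E := E) fun _ => 1
    simp only [mul_one, Finset.sum_const, Finset.card_univ, Fintype.card_fin, nsmul_eq_mul] at this
    rw [this]
    simp only [div_self hn', mul_one]
    exact inv_mul_cancel₀ hpos.ne'

/-- The probability of `E` under the i.i.d. law of `q` is at most `exp (-n D)`, where `D` is the
relative entropy of the time-averaged conditional law given `E`. This is the superadditivity of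
relative entropy with respect to product laws combined with its convexity; the proof is the
inequality `log x ≤ x - 1` applied to the likelihood ratio of the product of the averaged laws and
the conditional law. -/
theorem mul_relEntropy_averageConditional_le (hq : ∀ z, 0 < q z) (hn : 0 < n) (hE : E.Nonempty) :
    n * relEntropy (averageConditional q n E) q ≤ -Real.log (∑ w ∈ E, ∏ t, q (w t)) := by
  set R := averageConditional q n E with hR
  set s := ∑ w ∈ E, ∏ t, q (w t) with hs
  have hqw : ∀ w : Fin n → Z, 0 < ∏ t, q (w t) := fun w => Finset.prod_pos fun t _ => hq _
  have hpos : 0 < s := Finset.sum_pos (fun w _ => hqw w) hE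
  have hn' : (n : ℝ) ≠ 0 := by positivity
  have hRs := averageConditional_mem_stdSimplex hq hn hE
  have h1 : n * relEntropy R q =
      s⁻¹ * ∑ w ∈ E, (∏ t, q (w t)) * ∑ t, Real.log (R (w t) / q (w t)) := by
    rw [relEntropy, hR, sum_averageConditional_mul, mul_left_comm, Finset.mul_sum]
    congr 1
    refine Finset.sum_congr rfl fun w _ => ?_
    field_simp
  have h2 : ∀ w ∈ E, (∏ t, q (w t)) * (∑ t, Real.log (R (w t) / q (w t)) + Real.log s) ≤
      s * (∏ t, R (w t)) - ∏ t, q (w t) := by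
    intro w hw
    have hRw : ∀ t, 0 < R (w t) := fun t => averageConditional_pos hq hw t
    have hRw' : 0 < ∏ t, R (w t) := Finset.prod_pos fun t _ => hRw t
    rw [← Real.log_prod fun t _ => (div_pos (hRw t) (hq _)).ne', Finset.prod_div_distrib,
      ← Real.log_mul (div_pos hRw' (hqw w)).ne' hpos.ne']
    have := mul_le_mul_of_nonneg_left (Real.log_le_sub_one_of_pos
      (mul_pos (div_pos hRw' (hqw w)) hpos)) (hqw w).le
    refine this.trans_eq ?_
    have := (hqw w).ne'
    field_simp
  have h3 : ∑ w ∈ E, ∏ t, R (w t) ≤ 1 := by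
    rw [← sum_prod_eq_one hRs.2 n]
    exact Finset.sum_le_sum_of_subset_of_nonneg (Finset.subset_univ _) fun w _ _ =>
      Finset.prod_nonneg fun t _ => hRs.1 _
  have h4 := Finset.sum_le_sum h2
  rw [Finset.sum_sub_distrib, ← Finset.mul_sum] at h4
  simp only [mul_add, Finset.sum_add_distrib, ← Finset.sum_mul] at h4
  rw [← hs] at h4
  have h5 : ∑ w ∈ E, (∏ t, q (w t)) * ∑ t, Real.log (R (w t) / q (w t)) ≤ s * -Real.log s := by
    nlinarith
  rw [h1, inv_mul_le_iff₀ hpos]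
  exact h5

variable [MeasurableSpace Z] [MeasurableSingletonClass Z]

/-- An upper Sanov bound without polynomial factor. -/
theorem exists_iidLaw_nearConstraints_le [Finite J] (Q : PMF Z) (hQ : ∀ z, 0 < Q z)
    {u : J → Z → ℝ} {c : J → ℝ} {D d : ℝ}
    (hD : ∀ p ∈ linearFamily u c, D ≤ relEntropy p Q.toRealFun) (hd : d < D) :
    ∃ μ > 0, ∀ n : ℕ, 0 < n →
      iidLaw Q n (nearConstraints u c μ n) ≤ ENNReal.ofReal (Real.exp (-(n * d))) := by
  classical
  have hq : ∀ z, 0 < Q.toRealFun z := fun z => PMF.toRealFun_pos (hQ z)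
  obtain ⟨μ, hμ, H⟩ := exists_relEntropy_gt_of_near hq hD hd
  refine ⟨μ, hμ, fun n hn => ?_⟩
  rw [iidLaw_apply]
  refine ENNReal.ofReal_le_ofReal ?_
  simp only [mul_ite, mul_one, mul_zero]
  rw [← Finset.sum_filter]
  set E := Finset.univ.filter fun w : Fin n → Z => w ∈ nearConstraints u c μ n with hEdef
  rcases E.eq_empty_or_nonempty with h | hE
  · rw [h, Finset.sum_empty]
    exact (Real.exp_pos _).le
  have hqw : ∀ w : Fin n → Z, 0 < ∏ t, Q.toRealFun (w t) := fun w =>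
    Finset.prod_pos fun t _ => hq _
  have hpos : 0 < ∑ w ∈ E, ∏ t, Q.toRealFun (w t) := Finset.sum_pos (fun w _ => hqw w) hE
  have h1 := H _ (averageConditional_mem_stdSimplex hq hn hE) fun j => by
    have : ∑ a, averageConditional Q.toRealFun n E a * u j a - c j =
        (∑ w ∈ E, ∏ t, Q.toRealFun (w t))⁻¹ *
          ∑ w ∈ E, (∏ t, Q.toRealFun (w t)) * ((∑ t, u j (w t)) / n - c j) := by
      rw [sum_averageConditional_mul]
      simp only [mul_sub, Finset.sum_sub_distrib, ← Finset.sum_mul]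
      field_simp
    rw [this, abs_mul, abs_of_pos (inv_pos.2 hpos), inv_mul_le_iff₀ hpos, Finset.sum_mul]
    refine (Finset.abs_sum_le_sum_abs _ _).trans (Finset.sum_le_sum fun w hw => ?_)
    rw [abs_mul, abs_of_pos (hqw w)]
    exact mul_le_mul_of_nonneg_left ((Finset.mem_filter.1 hw).2 j) (hqw w).le
  have h2 := mul_relEntropy_averageConditional_le hq hn hE
  rw [← Real.log_le_iff_le_exp hpos]
  have h3 : (n : ℝ) * d ≤ n * relEntropy (averageConditional Q.toRealFun n E) Q.toRealFun :=
    mul_le_mul_of_nonneg_left h1.le (Nat.cast_nonneg n)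
  linarith

/-- Chebyshev's inequality for the empirical averages of features with values in `[0, 1]`. -/
theorem iidLaw_compl_nearConstraints_le [Fintype J] (P : PMF Z) {u : J → Z → ℝ}
    (hu : ∀ j z, u j z ∈ Set.Icc (0 : ℝ) 1) {μ : ℝ} (hμ : 0 < μ) {n : ℕ} (hn : 0 < n) :
    iidLaw P n (nearConstraints u (fun j => ∑ z, P.toRealFun z * u j z) μ n)ᶜ ≤
      ENNReal.ofReal (Fintype.card J / (n * μ ^ 2)) := by
  have hn' : (0 : ℝ) < n := Nat.cast_pos.2 hn
  have hL : ∀ j, MemLp (u j) 2 P.toMeasure := fun j =>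
    MemLp.of_bound (measurable_of_finite _).aestronglyMeasurable 1
      (Eventually.of_forall fun z => by
        rw [Real.norm_eq_abs, abs_of_nonneg (hu j z).1]; exact (hu j z).2)
  have hint : ∀ j, ∫ z, u j z ∂P.toMeasure = ∑ z, P.toRealFun z * u j z := fun j => by
    rw [integral_fintype Integrable.of_finite]
    refine Finset.sum_congr rfl fun z _ => ?_
    rw [Measure.real, P.toMeasure_apply_singleton z (measurableSet_singleton z)]
    rfl
  have hvar : ∀ j, ProbabilityTheory.variance (u j) P.toMeasure ≤ 1 := fun j => by
    refine (ProbabilityTheory.variance_le_sq_of_bounded (a := 0) (b := 1)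
      (Eventually.of_forall (hu j)) (measurable_of_finite _).aemeasurable).trans ?_
    norm_num
  have hone : ∀ j, iidLaw P n {w | μ < |(∑ t, u j (w t)) / n - ∑ z, P.toRealFun z * u j z|} ≤
      ENNReal.ofReal (1 / (n * μ ^ 2)) := by
    intro j
    have hmem : MemLp (∑ t : Fin n, fun w : Fin n → Z => u j (w t)) 2 (iidLaw P n) :=
      memLp_finsetSum' _ fun t _ => by
        refine MemLp.of_bound (measurable_of_finite _).aestronglyMeasurable 1
          (Eventually.of_forall fun w => ?_)
        rw [Real.norm_eq_abs, abs_of_nonneg (hu j _).1]; exact (hu j _).2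
    have hexp : ∫ w, (∑ t : Fin n, fun w : Fin n → Z => u j (w t)) w ∂iidLaw P n =
        n * ∑ z, P.toRealFun z * u j z := by
      simp only [Finset.sum_apply]
      rw [integral_finsetSum _ fun t _ => Integrable.of_finite]
      have : ∀ t : Fin n, ∫ w, u j (w t) ∂iidLaw P n = ∑ z, P.toRealFun z * u j z := fun t => by
        rw [← hint j, ← (measurePreserving_eval (fun _ : Fin n => P.toMeasure) t).map_eq,
          integral_map (measurable_pi_apply t).aemeasurable
            (measurable_of_finite _).aestronglyMeasurable]
        rfl
      simp [this]
    have hv : ProbabilityTheory.variance (∑ t : Fin n, fun w : Fin n → Z => u j (w t))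
        (iidLaw P n) ≤ n := by
      rw [iidLaw, ProbabilityTheory.variance_sum_pi fun _ => hL j]
      refine (Finset.sum_le_sum fun t _ => hvar j).trans_eq ?_
      simp
    have := ProbabilityTheory.meas_ge_le_variance_div_sq hmem (mul_pos hn' hμ)
    refine (measure_mono fun w hw => ?_).trans (this.trans (ENNReal.ofReal_le_ofReal ?_))
    · rw [Set.mem_ofPred_eq, hexp]
      rw [Set.mem_ofPred_eq] at hw
      simp only [Finset.sum_apply]
      have : ∑ t, u j (w t) - n * ∑ z, P.toRealFun z * u j z =
          n * ((∑ t, u j (w t)) / n - ∑ z, P.toRealFun z * u j z) := by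
        field_simp
      rw [this, abs_mul, abs_of_pos hn']
      exact mul_le_mul_of_nonneg_left hw.le hn'.le
    · rw [div_le_div_iff₀ (by positivity) (by positivity)]
      nlinarith [mul_pos hn' (pow_pos hμ 2)]
  have hsub : (nearConstraints u (fun j => ∑ z, P.toRealFun z * u j z) μ n)ᶜ ⊆
      ⋃ j, {w | μ < |(∑ t, u j (w t)) / n - ∑ z, P.toRealFun z * u j z|} := by
    intro w hw
    simpa [nearConstraints] using hw
  refine (measure_mono hsub).trans ((measure_iUnion_fintype_le _ _).trans
    ((Finset.sum_le_sum fun j _ => hone j).trans_eq ?_))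
  rw [Finset.sum_const, nsmul_eq_mul, Finset.card_univ, ← ENNReal.ofReal_natCast,
    ← ENNReal.ofReal_mul (Nat.cast_nonneg _)]
  congr 1
  ring

end EmpiricalAverage

/-- A sequence bounded above by `exp (-n d)` has exponent at least `d`. -/
theorem le_errorExponent_of_le {β : ℕ → ℝ≥0∞} {d : ℝ}
    (h : ∀ᶠ n : ℕ in atTop, β n ≤ ENNReal.ofReal (Real.exp (-(n * d)))) :
    (d : EReal) ≤ errorExponent β := by
  refine le_liminf_of_le (by isBoundedDefault) ?_
  filter_upwards [h, eventually_gt_atTop 0] with n hn hn0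
  rw [EReal.le_div_iff_mul_le (by exact_mod_cast hn0) (EReal.natCast_ne_top n), EReal.le_neg]
  refine (ENNReal.log_monotone hn).trans (le_of_eq ?_)
  rw [ENNReal.log_pos_real' (by rw [ENNReal.toReal_ofReal (Real.exp_pos _).le]; positivity),
    ENNReal.toReal_ofReal (Real.exp_pos _).le, Real.log_exp, ← EReal.coe_natCast, ← EReal.coe_mul,
    ← EReal.coe_neg, mul_comm]

/-! ### Fixed marginals as linear constraints -/

section Marginals

variable {Z A : Type*}

open Classical in
/-- The indicator function of `π z = a`; its expectation is the weight of `a` in the image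
under `π`. -/
noncomputable def indicatorFeature (π : Z → A) (a : A) (z : Z) : ℝ := if π z = a then 1 else 0

theorem indicatorFeature_mem_Icc (π : Z → A) (a : A) (z : Z) :
    indicatorFeature π a z ∈ Set.Icc (0 : ℝ) 1 := by
  unfold indicatorFeature
  split_ifs <;> simp

theorem sum_toRealFun_mul_indicatorFeature [Fintype Z] (P : PMF Z) (π : Z → A) (a : A) :
    ∑ z, P.toRealFun z * indicatorFeature π a z = (P.map π).toRealFun a :=
  (P.toRealFun_map π a).symm

theorem exists_pmf_relEntropy_min {J : Type*} [Fintype Z] {Q : PMF Z} (hQ : ∀ z, 0 < Q z)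
    {u : J → Z → ℝ} {c : J → ℝ} {P : PMF Z} (hP : P.toRealFun ∈ linearFamily u c) :
    ∃ Pt : PMF Z, Pt.toRealFun ∈ linearFamily u c ∧
      ∀ p ∈ linearFamily u c, relEntropy Pt.toRealFun Q.toRealFun ≤ relEntropy p Q.toRealFun := by
  obtain ⟨p, hp, hmin⟩ := exists_relEntropy_min (fun z => PMF.toRealFun_pos (hQ z)) ⟨_, hP⟩
  obtain ⟨Pt, rfl⟩ := PMF.exists_toRealFun_eq hp.1
  exact ⟨Pt, hp, hmin⟩

/-- The sequences whose empirical distribution differs from `R` by at most `μ` at every symbol. -/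
def typicalSet (R : PMF A) (μ : ℝ) (n : ℕ) : Set (Fin n → A) :=
  nearConstraints (indicatorFeature id) R.toRealFun μ n

variable {X Y₁ Y₂ : Type*}

/-- The features whose expectations are the two marginals of a pmf on `X × Y₁`. -/
noncomputable def pairFeatures : X ⊕ Y₁ → X × Y₁ → ℝ :=
  Sum.elim (indicatorFeature Prod.fst) (indicatorFeature Prod.snd)

/-- The features whose expectations are the three marginals of a pmf on `X × Y₁ × Y₂`. -/
noncomputable def tripleFeatures : X ⊕ Y₁ ⊕ Y₂ → X × Y₁ × Y₂ → ℝ :=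
  Sum.elim (indicatorFeature fun z => z.1)
    (Sum.elim (indicatorFeature fun z => z.2.1) (indicatorFeature fun z => z.2.2))

/-- The marginals on `X` and `Y₁` of `P`. -/
noncomputable def pairMarginals (P : PMF (X × Y₁ × Y₂)) : X ⊕ Y₁ → ℝ :=
  Sum.elim P.margX.toRealFun P.margY₁.toRealFun

/-- The marginals on `X`, `Y₁` and `Y₂` of `P`. -/
noncomputable def tripleMarginals (P : PMF (X × Y₁ × Y₂)) : X ⊕ Y₁ ⊕ Y₂ → ℝ :=
  Sum.elim P.margX.toRealFun (Sum.elim P.margY₁.toRealFun P.margY₂.toRealFun)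

theorem mem_nearConstraints_pair {P : PMF (X × Y₁ × Y₂)} {μ : ℝ} {n : ℕ} {w : Fin n → X × Y₁} :
    w ∈ nearConstraints pairFeatures (pairMarginals P) μ n ↔
      (fun t => (w t).1) ∈ typicalSet P.margX μ n ∧
        (fun t => (w t).2) ∈ typicalSet P.margY₁ μ n :=
  Sum.forall

theorem mem_nearConstraints_triple {P : PMF (X × Y₁ × Y₂)} {μ : ℝ} {n : ℕ}
    {z : Fin n → X × Y₁ × Y₂} :
    z ∈ nearConstraints tripleFeatures (tripleMarginals P) μ n ↔
      (fun t => (z t).1) ∈ typicalSet P.margX μ n ∧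
        (fun t => (z t).2.1) ∈ typicalSet P.margY₁ μ n ∧
          (fun t => (z t).2.2) ∈ typicalSet P.margY₂ μ n :=
  Sum.forall.trans (and_congr Iff.rfl Sum.forall)

variable [Fintype X] [Fintype Y₁]

theorem toRealFun_mem_linearFamily_pair {P : PMF (X × Y₁ × Y₂)} {Pt : PMF (X × Y₁)} :
    Pt.toRealFun ∈ linearFamily pairFeatures (pairMarginals P) ↔
      Pt.map Prod.fst = P.margX ∧ Pt.map Prod.snd = P.margY₁ := by
  simp only [linearFamily, Set.mem_ofPred_eq, Pt.toRealFun_mem_stdSimplex, true_and, Sum.forall,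
    pairFeatures, pairMarginals, Sum.elim_inl, Sum.elim_inr, sum_toRealFun_mul_indicatorFeature]
  simp only [← funext_iff, PMF.toRealFun_injective.eq_iff]

variable [Fintype Y₂]

theorem toRealFun_mem_linearFamily_triple {P Pt : PMF (X × Y₁ × Y₂)} :
    Pt.toRealFun ∈ linearFamily tripleFeatures (tripleMarginals P) ↔
      Pt.margX = P.margX ∧ Pt.margY₁ = P.margY₁ ∧ Pt.margY₂ = P.margY₂ := by
  simp only [linearFamily, Set.mem_ofPred_eq, Pt.toRealFun_mem_stdSimplex, true_and, Sum.forall,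
    tripleFeatures, tripleMarginals, Sum.elim_inl, Sum.elim_inr,
    sum_toRealFun_mul_indicatorFeature]
  simp only [← funext_iff, PMF.toRealFun_injective.eq_iff]
  rfl

theorem tripleMarginals_eq (P : PMF (X × Y₁ × Y₂)) :
    tripleMarginals P = fun j => ∑ z, P.toRealFun z * tripleFeatures j z :=
  funext fun j => ((toRealFun_mem_linearFamily_triple.2 ⟨rfl, rfl, rfl⟩).2 j).symm

end Marginals

/-! ### Converse -/

/-- If the complement of a union of boundedly many rectangles has vanishing probability under `P`,
the exponent of the probability of the union under `Q` is at most `D(Pt‖Q)` for every `Pt` with the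
same marginals as `P`: one of the rectangles has probability bounded below under `P`, hence so have
its sides. -/
theorem errorExponent_le_relEntropy {Z A B C ι : Type*} [Fintype Z] [Fintype A] [Fintype B]
    [Fintype C] [Fintype ι] [MeasurableSpace Z] [MeasurableSpace A] [MeasurableSpace B]
    [MeasurableSpace C] [MeasurableSingletonClass Z] [MeasurableSingletonClass A]
    [MeasurableSingletonClass B] [MeasurableSingletonClass C]
    {P Pt Q : PMF Z} (hQ : ∀ z, 0 < Q z) {πA : Z → A} {πB : Z → B} {πC : Z → C}
    (hsurj : ∀ x y w, ∃ z, πA z = x ∧ πB z = y ∧ πC z = w)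
    (hA : Pt.map πA = P.map πA) (hB : Pt.map πB = P.map πB) (hC : Pt.map πC = P.map πC)
    {acc : ∀ n : ℕ, Set (Fin n → Z)} (S : ∀ n : ℕ, ι → Set (Fin n → A))
    (T : ∀ n : ℕ, ι → Set (Fin n → B)) (U : ∀ n : ℕ, ι → Set (Fin n → C))
    (hacc : ∀ n z, z ∈ acc n ↔ ∃ i, (fun t => πA (z t)) ∈ S n i ∧ (fun t => πB (z t)) ∈ T n i ∧
      (fun t => πC (z t)) ∈ U n i)
    (hα : limsup (fun n => iidLaw P n (acc n)ᶜ) atTop ≤ 0) :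
    errorExponent (fun n => iidLaw Q n (acc n)) ≤
      (relEntropy Pt.toRealFun Q.toRealFun : ℝ) := by
  -- Among `card ι` rectangles covering probability `1 / 2`, one has probability at least `ε`.
  set ε : ℝ := 1 / (2 * (Fintype.card ι + 1)) with hε_def
  have hε : 0 < ε := by positivity
  rw [← EReal.le_of_forall_lt_iff_le]
  intro d hd
  have hδ : 0 < d - relEntropy Pt.toRealFun Q.toRealFun := sub_pos.2 (EReal.coe_lt_coe_iff.1 hd)
  obtain ⟨r, hr, H⟩ := exists_iidLaw_rectangle_ge Pt Q hQ πA πB πC hsurj hδ hε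
  refine errorExponent_le_of_le hr ?_
  have hα' : ∀ᶠ n in atTop, iidLaw P n (acc n)ᶜ < ENNReal.ofReal (1 / 2) :=
    eventually_lt_of_limsup_lt (hα.trans_lt (by simp))
  filter_upwards [hα'] with n hn
  have hunion : acc n = ⋃ i, {z | (fun t => πA (z t)) ∈ S n i ∧ (fun t => πB (z t)) ∈ T n i ∧
      (fun t => πC (z t)) ∈ U n i} := by
    ext z
    simp [hacc]
  obtain ⟨i, hi⟩ : ∃ i, ENNReal.ofReal ε ≤ iidLaw P n {z | (fun t => πA (z t)) ∈ S n i ∧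
      (fun t => πB (z t)) ∈ T n i ∧ (fun t => πC (z t)) ∈ U n i} := by
    by_contra! hlt
    have h1 : iidLaw P n (acc n) ≤ ENNReal.ofReal (1 / 2) := by
      rw [hunion]
      refine (measure_iUnion_fintype_le _ _).trans
        ((Finset.sum_le_sum fun i _ => (hlt i).le).trans ?_)
      rw [Finset.sum_const, nsmul_eq_mul, Finset.card_univ, ← ENNReal.ofReal_natCast,
        ← ENNReal.ofReal_mul (Nat.cast_nonneg _)]
      refine ENNReal.ofReal_le_ofReal ?_
      rw [hε_def, mul_one_div, div_le_div_iff₀ (by positivity) (by positivity)]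
      linarith
    have h2 : iidLaw P n (acc n) + iidLaw P n (acc n)ᶜ < 1 := by
      refine (ENNReal.add_lt_add_of_le_of_lt (by finiteness) h1 hn).trans_eq ?_
      rw [← ENNReal.ofReal_add (by norm_num) (by norm_num)]
      norm_num
    rw [measure_add_measure_compl (acc n).toFinite.measurableSet, measure_univ] at h2
    exact lt_irrefl _ h2
  have hS : ENNReal.ofReal ε ≤ iidLaw (Pt.map πA) n (S n i) := by
    rw [hA, iidLaw_map_apply]
    exact hi.trans (measure_mono fun z hz => hz.1)
  have hT : ENNReal.ofReal ε ≤ iidLaw (Pt.map πB) n (T n i) := by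
    rw [hB, iidLaw_map_apply]
    exact hi.trans (measure_mono fun z hz => hz.2.1)
  have hU : ENNReal.ofReal ε ≤ iidLaw (Pt.map πC) n (U n i) := by
    rw [hC, iidLaw_map_apply]
    exact hi.trans (measure_mono fun z hz => hz.2.2)
  refine le_trans (le_of_eq ?_) ((H n _ _ _ hS hT hU).trans (measure_mono ?_))
  · rw [add_sub_cancel]
  · rw [hunion]
    exact Set.subset_iUnion (fun i => {z : Fin n → Z | (fun t => πA (z t)) ∈ S n i ∧
      (fun t => πB (z t)) ∈ T n i ∧ (fun t => πC (z t)) ∈ U n i}) i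

theorem fin_two_eq_one_iff {i : Fin 2} : i = 1 ↔ i ≠ 0 := by
  revert i; decide

theorem margXY₁_pos {X Y₁ Y₂ : Type*} {Pbar : PMF (X × Y₁ × Y₂)}
    (hPbar : ∀ x y₁ y₂, 0 < Pbar (x, y₁, y₂)) (z : X × Y₁) :
    0 < Pbar.margXY₁ z := by
  obtain ⟨⟨_, _, y₂⟩, _⟩ := Pbar.support_nonempty
  have h : (z.1, z.2, y₂) ∈ Pbar.support := (Pbar.mem_support_iff _).2 (hPbar _ _ _).ne'
  have : z ∈ Pbar.margXY₁.support := by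
    rw [PMF.margXY₁, PMF.mem_support_map_iff]
    exact ⟨_, h, rfl⟩
  exact pos_iff_ne_zero.2 ((PMF.mem_support_iff _ _).1 this)

section Converse

variable {X Y₁ Y₂ : Type*} [Fintype X] [Fintype Y₁] [Fintype Y₂]
  [MeasurableSpace X] [MeasurableSpace Y₁] [MeasurableSpace Y₂]
  [MeasurableSingletonClass X] [MeasurableSingletonClass Y₁] [MeasurableSingletonClass Y₂]
  {P Pbar : PMF (X × Y₁ × Y₂)} {W₁ W₂ : ℕ}

theorem converse_detector₁ (hPbar : ∀ x y₁ y₂, 0 < Pbar (x, y₁, y₂)) {Pt : PMF (X × Y₁)}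
    (hX : Pt.map Prod.fst = P.margX) (hY₁ : Pt.map Prod.snd = P.margY₁)
    {s : ∀ n : ℕ, Scheme X Y₁ Y₂ W₁ W₂ n}
    (hα : limsup (fun n => iidLaw P n {z | (s n).decision₁ z = 1}) atTop ≤ 0) :
    errorExponent (fun n => iidLaw Pbar n {z | (s n).decision₁ z = 0}) ≤
      (relEntropy Pt.toRealFun Pbar.margXY₁.toRealFun : ℝ) := by
  set acc : ∀ n, Set (Fin n → X × Y₁) := fun n =>
    {w | (s n).ψ₁ ((s n).φ₁ fun t => (w t).1) (fun t => (w t).2) = 0} with hacc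
  have h0 : ∀ n, iidLaw Pbar n {z | (s n).decision₁ z = 0} = iidLaw Pbar.margXY₁ n (acc n) :=
    fun n => (iidLaw_map_apply Pbar (fun z => (z.1, z.2.1)) n (acc n)).symm
  have h1 : ∀ n, iidLaw P n {z | (s n).decision₁ z = 1} = iidLaw P.margXY₁ n (acc n)ᶜ := by
    intro n
    simp_rw [fin_two_eq_one_iff]
    exact (iidLaw_map_apply P (fun z => (z.1, z.2.1)) n (acc n)ᶜ).symm
  simp_rw [h0]
  simp_rw [h1] at hα
  refine errorExponent_le_relEntropy (C := Unit) (P := P.margXY₁) (margXY₁_pos hPbar)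
    (πA := Prod.fst) (πB := Prod.snd) (πC := fun _ => ()) (fun x y _ => ⟨(x, y), rfl, rfl, rfl⟩)
    ?_ ?_ ?_ (fun n m => {x | (s n).φ₁ x = m}) (fun n m => {y | (s n).ψ₁ m y = 0})
    (fun _ _ => Set.univ) (fun n z => ?_) hα
  · rw [hX, PMF.margXY₁, PMF.map_comp]
    rfl
  · rw [hY₁, PMF.margXY₁, PMF.map_comp]
    rfl
  · exact (PMF.map_const Pt ()).trans (PMF.map_const _ ()).symm
  · simp [hacc]

theorem converse_detector₂ (hPbar : ∀ x y₁ y₂, 0 < Pbar (x, y₁, y₂)) {Pt : PMF (X × Y₁ × Y₂)}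
    (hX : Pt.margX = P.margX) (hY₁ : Pt.margY₁ = P.margY₁) (hY₂ : Pt.margY₂ = P.margY₂)
    {s : ∀ n : ℕ, Scheme X Y₁ Y₂ W₁ W₂ n}
    (hα : limsup (fun n => iidLaw P n {z | (s n).decision₂ z = 1}) atTop ≤ 0) :
    errorExponent (fun n => iidLaw Pbar n {z | (s n).decision₂ z = 0}) ≤
      (relEntropy Pt.toRealFun Pbar.toRealFun : ℝ) := by
  simp_rw [fin_two_eq_one_iff] at hα
  refine errorExponent_le_relEntropy (ι := Fin W₁ × Fin W₂) (fun z => hPbar z.1 z.2.1 z.2.2)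
    (fun x y w => ⟨(x, y, w), rfl, rfl, rfl⟩) hX hY₁ hY₂
    (fun n m => {x | (s n).φ₁ x = m.1}) (fun n m => {y | (s n).φ₂ m.1 y = m.2})
    (fun n m => {w | (s n).ψ₂ m.1 m.2 w = 0}) (fun n z => ?_) hα
  simp [Scheme.decision₂, Scheme.M₁, Scheme.M₂]

end Converse

/-! ### Achievability -/

/-- The exponent of the probability of nearly satisfying linear constraints, with tolerance tending
to zero, is at least the minimal relative entropy under the constraints, and nonnegative. -/
theorem le_errorExponent_nearConstraints {Z J : Type*} [Fintype Z] [Finite J] [MeasurableSpace Z]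
    [MeasurableSingletonClass Z] {Q : PMF Z} (hQ : ∀ z, 0 < Q z) {u : J → Z → ℝ} {c : J → ℝ}
    {D : ℝ} (hD : ∀ p ∈ linearFamily u c, D ≤ relEntropy p Q.toRealFun) {μ : ℕ → ℝ}
    (hμ : Tendsto μ atTop (𝓝 0)) :
    ((max D 0 : ℝ) : EReal) ≤
      errorExponent fun n => iidLaw Q n (nearConstraints u c (μ n) n) := by
  have h0 : ((0 : ℝ) : EReal) ≤
      errorExponent fun n => iidLaw Q n (nearConstraints u c (μ n) n) :=
    le_errorExponent_of_le (Eventually.of_forall fun n => by simpa using prob_le_one)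
  rcases le_total D 0 with h | h
  · rwa [max_eq_right h]
  rw [max_eq_left h, ← EReal.ge_of_forall_gt_iff_ge]
  intro d hd
  obtain ⟨μ₀, hμ₀, H⟩ := exists_iidLaw_nearConstraints_le Q hQ hD (EReal.coe_lt_coe_iff.1 hd)
  refine le_errorExponent_of_le ?_
  filter_upwards [hμ.eventually_le_const hμ₀, eventually_gt_atTop 0] with n hn hn0
  exact (measure_mono (nearConstraints_mono u c hn n)).trans (H n hn0)

/-- The tolerance `n ^ (-1/4)` tends to zero slowly enough for Chebyshev's inequality. -/
theorem exists_tolerance :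
    ∃ μ : ℕ → ℝ, (∀ n, 0 < n → 0 < μ n) ∧ Tendsto μ atTop (𝓝 0) ∧
      Tendsto (fun n : ℕ => n * μ n ^ 2) atTop atTop := by
  have hs : Tendsto (fun n : ℕ => √(n : ℝ)) atTop atTop :=
    Real.tendsto_sqrt_atTop.comp tendsto_natCast_atTop_atTop
  refine ⟨fun n => (√√(n : ℝ))⁻¹, fun n hn => ?_,
    tendsto_inv_atTop_zero.comp (Real.tendsto_sqrt_atTop.comp hs), ?_⟩
  · have : (0 : ℝ) < n := Nat.cast_pos.2 hn
    positivity
  · refine hs.congr fun n => ?_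
    rw [inv_pow, Real.sq_sqrt (Real.sqrt_nonneg _), ← div_eq_mul_inv, Real.div_sqrt]

section Achievability

variable {X Y₁ Y₂ : Type*} {P Pbar : PMF (X × Y₁ × Y₂)} {W₁ W₂ : ℕ}

open Classical in
/-- The sensor sends `0` if its observations are `μ`-typical for the marginal of `P`, and `1`
otherwise. A detector decides for hypothesis `0` if its own observations are typical and the message
of its predecessor is `0`, and Detector 1 forwards its decision. As the message of Detector 1 already
accounts for that of the sensor, Detector 2 ignores the latter. -/
noncomputable def typicalityScheme (P : PMF (X × Y₁ × Y₂)) (hW₁ : 2 ≤ W₁) (hW₂ : 2 ≤ W₂) (μ : ℝ)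
    (n : ℕ) : Scheme X Y₁ Y₂ W₁ W₂ n where
  φ₁ x := if x ∈ typicalSet P.margX μ n then ⟨0, by omega⟩ else ⟨1, by omega⟩
  φ₂ m y := if m.1 = 0 ∧ y ∈ typicalSet P.margY₁ μ n then ⟨0, by omega⟩ else ⟨1, by omega⟩
  ψ₁ m y := if m.1 = 0 ∧ y ∈ typicalSet P.margY₁ μ n then 0 else 1
  ψ₂ _ m w := if m.1 = 0 ∧ w ∈ typicalSet P.margY₂ μ n then 0 else 1

theorem typicalityScheme_decision₁_eq_zero_iff (hW₁ : 2 ≤ W₁) (hW₂ : 2 ≤ W₂) {μ : ℝ} {n : ℕ}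
    {z : Fin n → X × Y₁ × Y₂} :
    (typicalityScheme P hW₁ hW₂ μ n).decision₁ z = 0 ↔
      (fun t => (z t).1) ∈ typicalSet P.margX μ n ∧
        (fun t => (z t).2.1) ∈ typicalSet P.margY₁ μ n := by
  by_cases h : (fun t => (z t).1) ∈ typicalSet P.margX μ n <;>
    simp [Scheme.decision₁, Scheme.M₁, typicalityScheme, h]

theorem typicalityScheme_decision₂_eq_zero_iff (hW₁ : 2 ≤ W₁) (hW₂ : 2 ≤ W₂) {μ : ℝ} {n : ℕ}
    {z : Fin n → X × Y₁ × Y₂} :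
    (typicalityScheme P hW₁ hW₂ μ n).decision₂ z = 0 ↔
      (fun t => (z t).1) ∈ typicalSet P.margX μ n ∧
        (fun t => (z t).2.1) ∈ typicalSet P.margY₁ μ n ∧
          (fun t => (z t).2.2) ∈ typicalSet P.margY₂ μ n := by
  by_cases h : (fun t => (z t).1) ∈ typicalSet P.margX μ n <;>
    by_cases h' : (fun t => (z t).2.1) ∈ typicalSet P.margY₁ μ n <;>
    simp [Scheme.decision₂, Scheme.M₁, Scheme.M₂, typicalityScheme, h, h']

variable [Fintype X] [Fintype Y₁] [Fintype Y₂]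
  [MeasurableSpace X] [MeasurableSpace Y₁] [MeasurableSpace Y₂]
  [MeasurableSingletonClass X] [MeasurableSingletonClass Y₁] [MeasurableSingletonClass Y₂]

theorem iidLaw_decision₁_eq_zero {Q : PMF (X × Y₁ × Y₂)} (hW₁ : 2 ≤ W₁) (hW₂ : 2 ≤ W₂) {μ : ℝ}
    (n : ℕ) : iidLaw Q n {z | (typicalityScheme P hW₁ hW₂ μ n).decision₁ z = 0} =
      iidLaw Q.margXY₁ n (nearConstraints pairFeatures (pairMarginals P) μ n) := by
  rw [PMF.margXY₁, iidLaw_map_apply]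
  congr 1
  ext z
  exact (typicalityScheme_decision₁_eq_zero_iff hW₁ hW₂).trans
    (mem_nearConstraints_pair (w := fun t => ((z t).1, (z t).2.1))).symm

/-- One sequence of typicality schemes attains both minimal relative entropies. -/
theorem exists_scheme (hPbar : ∀ x y₁ y₂, 0 < Pbar (x, y₁, y₂)) (hW₁ : 2 ≤ W₁) (hW₂ : 2 ≤ W₂)
    {D₁ D₂ : ℝ}
    (hD₁ : ∀ p ∈ linearFamily pairFeatures (pairMarginals P),
      D₁ ≤ relEntropy p Pbar.margXY₁.toRealFun)
    (hD₂ : ∀ p ∈ linearFamily tripleFeatures (tripleMarginals P),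
      D₂ ≤ relEntropy p Pbar.toRealFun) :
    ∃ s : ∀ n : ℕ, Scheme X Y₁ Y₂ W₁ W₂ n,
      limsup (fun n => iidLaw P n {z | (s n).decision₁ z = 1}) atTop ≤ 0 ∧
      limsup (fun n => iidLaw P n {z | (s n).decision₂ z = 1}) atTop ≤ 0 ∧
      ((max D₁ 0 : ℝ) : EReal) ≤
        errorExponent (fun n => iidLaw Pbar n {z | (s n).decision₁ z = 0}) ∧
      ((max D₂ 0 : ℝ) : EReal) ≤
        errorExponent (fun n => iidLaw Pbar n {z | (s n).decision₂ z = 0}) := by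
  obtain ⟨μ, hμpos, hμ0, hμn⟩ := exists_tolerance
  have hdec₂ : ∀ n, {z | (typicalityScheme P hW₁ hW₂ (μ n) n).decision₂ z = 0} =
      nearConstraints tripleFeatures (tripleMarginals P) (μ n) n := fun n => by
    ext z
    exact (typicalityScheme_decision₂_eq_zero_iff hW₁ hW₂).trans mem_nearConstraints_triple.symm
  have hα₂ : limsup (fun n => iidLaw P n
      {z | (typicalityScheme P hW₁ hW₂ (μ n) n).decision₂ z = 1}) atTop ≤ 0 := by
    have hlim : Tendsto (fun n : ℕ => ENNReal.ofReal
        (Fintype.card (X ⊕ Y₁ ⊕ Y₂) / (n * μ n ^ 2))) atTop (𝓝 0) := by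
      have := ENNReal.tendsto_ofReal (hμn.const_div_atTop (Fintype.card (X ⊕ Y₁ ⊕ Y₂) : ℝ))
      rwa [ENNReal.ofReal_zero] at this
    rw [← hlim.limsup_eq]
    refine limsup_le_limsup ?_
    filter_upwards [eventually_gt_atTop 0] with n hn
    have hu : ∀ (j : X ⊕ Y₁ ⊕ Y₂) z, tripleFeatures j z ∈ Set.Icc (0 : ℝ) 1 := by
      rintro (x | y | w) z <;> exact indicatorFeature_mem_Icc _ _ _
    have := iidLaw_compl_nearConstraints_le P hu (hμpos n hn) hn
    rw [← tripleMarginals_eq, ← hdec₂] at this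
    simp_rw [fin_two_eq_one_iff]
    exact this
  refine ⟨fun n => typicalityScheme P hW₁ hW₂ (μ n) n, ?_, hα₂, ?_, ?_⟩
  · -- Detector 2 decides for hypothesis `1` whenever Detector 1 does.
    refine le_trans (limsup_le_limsup (Eventually.of_forall fun n => measure_mono fun z hz => ?_))
      hα₂
    simp only [Set.mem_ofPred_eq, fin_two_eq_one_iff, ne_eq, typicalityScheme_decision₁_eq_zero_iff,
      typicalityScheme_decision₂_eq_zero_iff] at hz ⊢
    exact fun h => hz ⟨h.1, h.2.1⟩
  · refine (le_errorExponent_nearConstraints (margXY₁_pos hPbar) hD₁ hμ0).trans_eq ?_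
    exact congrArg errorExponent (funext fun n => (iidLaw_decision₁_eq_zero hW₁ hW₂ n).symm)
  · refine (le_errorExponent_nearConstraints (fun z => hPbar z.1 z.2.1 z.2.2) hD₂ hμ0).trans_eq ?_
    exact congrArg errorExponent (funext fun n => by rw [hdec₂])

end Achievability

/-! ### The region -/

/-- Coherent detection (`h̄₁ = 1`): the region is the rectangle with sides `D₁` and `D₂`, where `D₁`
and `D₂` are the two minimal divergences, which are attained and finite. -/
theorem mainTheorem3 {X Y₁ Y₂ : Type*} [Fintype X] [Fintype Y₁] [Fintype Y₂]
    [MeasurableSpace X] [MeasurableSpace Y₁] [MeasurableSpace Y₂]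
    [MeasurableSingletonClass X] [MeasurableSingletonClass Y₁] [MeasurableSingletonClass Y₂]
    (P Pbar : PMF (X × Y₁ × Y₂))
    (hP : ∀ x y₁, 0 < P.margXY₁ (x, y₁)) (hPbar : ∀ x y₁ y₂, 0 < Pbar (x, y₁, y₂))
    (W₁ W₂ : ℕ) (hW₁ : 2 ≤ W₁) (hW₂ : 2 ≤ W₂) :
    ∃ D₁ D₂ : ℝ≥0,
      IsLeast (divergences₁ P Pbar) (D₁ : ℝ≥0∞) ∧
      IsLeast (divergences₂ P Pbar) (D₂ : ℝ≥0∞) ∧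
      exponentsRegion ![P, Pbar] 1 W₁ W₂ =
        {θ : ℝ × ℝ | 0 ≤ θ.1 ∧ 0 ≤ θ.2 ∧ θ.1 ≤ D₁ ∧ θ.2 ≤ D₂} := by
  have hPbar' : ∀ z, 0 < Pbar z := fun z => hPbar z.1 z.2.1 z.2.2
  have hpair : P.margXY₁.toRealFun ∈ linearFamily pairFeatures (pairMarginals P) := by
    rw [toRealFun_mem_linearFamily_pair, PMF.margXY₁, PMF.map_comp, PMF.map_comp]
    exact ⟨rfl, rfl⟩
  have htriple : P.toRealFun ∈ linearFamily tripleFeatures (tripleMarginals P) :=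
    toRealFun_mem_linearFamily_triple.2 ⟨rfl, rfl, rfl⟩
  obtain ⟨P₁, hP₁, hmin₁⟩ := exists_pmf_relEntropy_min (margXY₁_pos hPbar) hpair
  obtain ⟨P₂, hP₂, hmin₂⟩ := exists_pmf_relEntropy_min hPbar' htriple
  have hmarg₁ := toRealFun_mem_linearFamily_pair.1 hP₁
  have hmarg₂ := toRealFun_mem_linearFamily_triple.1 hP₂
  set D₁ := relEntropy P₁.toRealFun Pbar.margXY₁.toRealFun
  set D₂ := relEntropy P₂.toRealFun Pbar.toRealFun
  refine ⟨D₁.toNNReal, D₂.toNNReal, ⟨⟨P₁, hmarg₁.1, hmarg₁.2,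
    (P₁.divergence_eq_ofReal_relEntropy (margXY₁_pos hPbar)).symm⟩, ?_⟩,
    ⟨⟨P₂, hmarg₂.1, hmarg₂.2.1, hmarg₂.2.2,
    (P₂.divergence_eq_ofReal_relEntropy hPbar').symm⟩, ?_⟩, ?_⟩
  · rintro _ ⟨Pt, h1, h2, rfl⟩
    rw [Pt.divergence_eq_ofReal_relEntropy (margXY₁_pos hPbar)]
    exact ENNReal.ofReal_le_ofReal (hmin₁ _ (toRealFun_mem_linearFamily_pair.2 ⟨h1, h2⟩))
  · rintro _ ⟨Pt, h1, h2, h3, rfl⟩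
    rw [Pt.divergence_eq_ofReal_relEntropy hPbar']
    exact ENNReal.ofReal_le_ofReal (hmin₂ _ (toRealFun_mem_linearFamily_triple.2 ⟨h1, h2, h3⟩))
  refine Set.Subset.antisymm (closure_minimal ?_ ?_) (subset_closure.trans' ?_)
  · rintro θ ⟨h1, h2, s, hα₁, hα₂, hβ₁, hβ₂⟩
    refine ⟨h1, h2, ?_, ?_⟩
    · exact (EReal.coe_le_coe_iff.1 (hβ₁.trans
        (converse_detector₁ hPbar hmarg₁.1 hmarg₁.2 hα₁))).trans (Real.le_coe_toNNReal _)
    · exact (EReal.coe_le_coe_iff.1 (hβ₂.trans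
        (converse_detector₂ hPbar hmarg₂.1 hmarg₂.2.1 hmarg₂.2.2 hα₂))).trans
        (Real.le_coe_toNNReal _)
  · exact (isClosed_le continuous_const continuous_fst).inter
      ((isClosed_le continuous_const continuous_snd).inter
      ((isClosed_le continuous_fst continuous_const).inter
      (isClosed_le continuous_snd continuous_const)))
  · rintro θ ⟨h1, h2, h3, h4⟩
    obtain ⟨s, hα₁, hα₂, hβ₁, hβ₂⟩ := exists_scheme hPbar hW₁ hW₂ hmin₁ hmin₂
    exact ⟨h1, h2, s, hα₁, hα₂, (EReal.coe_le_coe_iff.2 h3).trans hβ₁,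
      (EReal.coe_le_coe_iff.2 h4).trans hβ₂⟩
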